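/- \textbf{Definitions.} Let $T$ be a complete first-order theory (models are non-empty). A formula $\phi(x,y)$, with $x,y$ finite tuples of variables, has IP if in some model of $T$, for every $n\in\mathbb N$, there are $a_1,\dots,a_n$ such that for every $J\subseteq\{1,\dots,n\}$ there is $b_J$ with $\phi(a_i,b_J)\Leftrightarrow i\in J$. The theory $T$ has IP if some formula has IP. For $I\subseteq\mathbb Z$ let $dns(I)=\lim_{n\to\infty}|I\cap[-n,n]|/n$, when this limit exists. For $\epsilon>0$, the set $I$ is $\epsilon$-wide if $dns(I)$ exists and, for every integer $n\neq 0$, $dns(I\cap(I+n))$ exists and $dns(I)-dns(I\cap(I+n))\geq\epsilon$. Let $\phi(x,y)$ be a formula with $x$ a single variable and $|y|=t$. \begin{itemize} \item $\phi$ is strong wide in a model $N$ of $T$ if there are $a\in N$, $c\in N^t$, $\sigma\in Aut(N)$ and $\epsilon>0$ such that $\{i\in\mathbb Z:\sigma^i(a)\in\phi(N,c)\}$ is $\epsilon$-wide. \item $\phi$ is weak wide in $N$ if there are pairwise distinct elements $a_n\in N$ $(n\in\mathbb Z)$, tuples $c_n\in N^t$ $(n\in\mathbb Z)$ and $\epsilon>0$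 such that, with $U_n=\{a_i:\phi(a_i,c_n)\}$, one has $U_n=\{a_{i+n}:a_i\in U_0\}$ for every $n\in\mathbb Z$, and $\{i:a_i\in U_0\}$ is $\epsilon$-wide. \end{itemize} The theory $T$ is strong (weak) wide if some such formula is strong (weak) wide in some model of $T$. For a structure $M$ and $A\subseteq M$ let $\mathcal A$ be the $\sigma$-algebra on $M$ generated by $Def(A)$, the subsets of $M$ definable with parameters from $A$. A countably additive probability measure $\mu$ on $\mathcal A$ is invariant under $\sigma\in Aut(M)$ if $\sigma$ and $\sigma^{-1}$ are $\mathcal A$-measurable and preserve $\mu$. The system $(M,\mathcal A,\mu,\sigma)$ is compact (almost periodic) if for every $\epsilon>0$ and every $B\in\mathcal A$ there is an integer $n\geq 1$ with $\mu(\sigma^n(B)\triangle B)<\epsilon$. \textbf{Theorem.} Let $M$ be a saturated model of $T$ which is not countably infinite. Then the following are equivalent: \begin{enumerate} \item $T$ has IP. \item There are a nontrivial automorphism $\sigma$ of $M$, a set $A\subseteq M$ and a $\sigma$-invariant countably additive probability measure $\mu$ on the $\sigma$-algebra $\mathcal A$ generated by $Def(A)$ such that $(M,\mathcal A,\mu,\sigma)$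 is not a compact system. \item The same as (2) with $A=M$ (that is, $\mu$ is a global measure). \item $T$ is weak wide. \item $T$ is strong wide. \end{enumerate} -/

import Mathlib

universe u v w

namespace WideNIP

open FirstOrder Filter Topology Cardinal MeasureTheory

section Integers

/-- `dns(I) = d`: the limit of `|I ∩ [-n, n]| / n` as `n → ∞` exists and equals `d`. -/
def HasDensity (I : Set ℤ) (d : ℝ) : Prop :=
  Tendsto (fun n : ℕ => ((I ∩ Set.Icc (-(n : ℤ)) (n : ℤ)).ncard : ℝ) / (n : ℝ)) atTop (𝓝 d)

/-- The translate `I + n` of a set of integers. -/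
def shift (n : ℤ) (I : Set ℤ) : Set ℤ := (fun i => i + n) '' I

/-- `I` is `ε`-wide: the densities of `I` and of `I ∩ (I + n)`, `n ≠ 0`, all exist, and
`dns(I) - dns(I ∩ (I + n)) ≥ ε` for every nonzero integer `n`. -/
def IsWide (ε : ℝ) (I : Set ℤ) : Prop :=
  ∃ d : ℝ, HasDensity I d ∧
    ∀ n : ℤ, n ≠ 0 → ∃ d' : ℝ, HasDensity (I ∩ shift n I) d' ∧ ε ≤ d - d'

end Integers

section Dynamics

/-- `ξ_{σ,B}(a) = {i ∈ ℤ : σ^i(a) ∈ B}`. -/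
def returnSet {X : Type w} (σ : Equiv.Perm X) (B : Set X) (a : X) : Set ℤ :=
  {i : ℤ | (σ ^ i) a ∈ B}

/-- `μ` is invariant under the permutation `σ`: both `σ` and its inverse are measurable and
preserve `μ`. -/
def IsInvariant {X : Type w} [MeasurableSpace X] (μ : Measure X) (σ : Equiv.Perm X) : Prop :=
  MeasurePreserving σ μ μ ∧ MeasurePreserving σ.symm μ μ

/-- The system is compact (almost periodic): for every `ε > 0` and every measurable `B` there is
a positive integer `n` with `μ (σ^n(B) ∆ B) < ε`. -/
def IsCompactSystem {X : Type w} [MeasurableSpace X] (μ : Measure X) (σ : Equiv.Perm X) : Prop :=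
  ∀ ε : ℝ, 0 < ε → ∀ B : Set X, MeasurableSet B →
    ∃ n : ℕ, 0 < n ∧ μ (symmDiff ((σ ^ n : Equiv.Perm X) '' B) B) < ENNReal.ofReal ε

end Dynamics

section Models

variable (L : FirstOrder.Language.{u, v}) (M : Type w) [L.Structure M]

/-- `M` is `κ`-saturated: every set of formulas in one variable with parameters from a set `A`
of fewer than `κ` elements of `M` which is finitely satisfiable in `M` is realized in `M`. -/
def IsKSaturated (κ : Cardinal.{w}) : Prop :=
  ∀ A : Set M, #A < κ → ∀ p : Set (L[[A]].Formula (Fin 1)),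
    (∀ s : Finset (L[[A]].Formula (Fin 1)), (s : Set (L[[A]].Formula (Fin 1))) ⊆ p →
      ∃ m : M, ∀ φ ∈ s, φ.Realize (fun _ => m)) →
    ∃ m : M, ∀ φ ∈ p, φ.Realize (fun _ => m)

/-- `M` is saturated: it is `|M|`-saturated. -/
def IsSaturated : Prop := IsKSaturated L M #M

/-- The σ-algebra on `M` generated by `Def(A)`, the subsets of `M` definable with parameters
from `A`. -/
@[reducible] def defSigmaAlgebra (A : Set M) : MeasurableSpace M :=
  MeasurableSpace.generateFrom {s : Set M | A.Definable₁ L s}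

/-- There are a nontrivial automorphism `σ` of `M` and a countably additive `σ`-invariant
probability measure `μ` on the σ-algebra generated by `Def(A)` such that the resulting
measure-preserving system is not compact. -/
def HasNoncompactSystem (A : Set M) : Prop :=
  letI : MeasurableSpace M := defSigmaAlgebra L M A
  ∃ σ : M ≃[L] M, σ ≠ FirstOrder.Language.Equiv.refl L M ∧
    ∃ μ : Measure M, IsProbabilityMeasure μ ∧ IsInvariant μ σ.toEquiv ∧
      ¬ IsCompactSystem μ σ.toEquiv

variable {L}

/-- The instance `φ(M, c)` of a formula `φ(x, y)` with `x` a single variable. -/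
def inst {t : ℕ} (φ : L.Formula (Fin 1 ⊕ Fin t)) (c : Fin t → M) : Set M :=
  {m : M | φ.Realize (Sum.elim (fun _ => m) c)}

/-- `φ(x, y)` is strong wide in `M`. -/
def StrongWideIn {t : ℕ} (φ : L.Formula (Fin 1 ⊕ Fin t)) : Prop :=
  ∃ (a : M) (c : Fin t → M) (σ : M ≃[L] M) (ε : ℝ), 0 < ε ∧
    IsWide ε (returnSet σ.toEquiv (inst M φ c) a)

/-- The set `U_n = {a_i : φ(a_i, c_n)}`. -/
def tracePart {t : ℕ} (φ : L.Formula (Fin 1 ⊕ Fin t)) (a : ℤ → M) (c : ℤ → Fin t → M) (n : ℤ) :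
    Set M :=
  {m : M | ∃ i : ℤ, a i = m ∧ a i ∈ inst M φ (c n)}

/-- `φ(x, y)` is weak wide in `M`, witnessed by a sequence `(a_n)` of pairwise distinct elements
and a sequence `(c_n)` of tuples: `U_n = {a_{i+n} : a_i ∈ U_0}` for every `n`, and
`{i : a_i ∈ U_0}` is `ε`-wide. -/
def WeakWideIn {t : ℕ} (φ : L.Formula (Fin 1 ⊕ Fin t)) : Prop :=
  ∃ (a : ℤ → M) (c : ℤ → Fin t → M) (ε : ℝ), Function.Injective a ∧ 0 < ε ∧
    (∀ n : ℤ, tracePart M φ a c n = {m : M | ∃ i : ℤ, a i ∈ tracePart M φ a c 0 ∧ m = a (i + n)}) ∧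
    IsWide ε {i : ℤ | a i ∈ tracePart M φ a c 0}

end Models

section Theories

variable {L : FirstOrder.Language.{u, v}} (T : L.Theory)

/-- `φ(x, y)` has the independence property in some model of `T`. -/
def FormulaHasIP {k t : ℕ} (φ : L.Formula (Fin k ⊕ Fin t)) : Prop :=
  ∃ N : FirstOrder.Language.Theory.ModelType.{u, v, max u v w} T, ∀ n : ℕ, ∃ a : Fin n → Fin k → N,
    ∀ J : Set (Fin n), ∃ b : Fin t → N, ∀ i : Fin n, φ.Realize (Sum.elim (a i) b) ↔ i ∈ J

/-- `T` has IP: some formula `φ(x, y)`, with `x` and `y` finite tuples of variables, has IP. -/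
def HasIP : Prop :=
  ∃ (k t : ℕ) (φ : L.Formula (Fin k ⊕ Fin t)), FormulaHasIP.{u, v, w} T φ

/-- `T` is weak wide: some formula is weak wide in some model of `T`. -/
def IsWeakWide : Prop :=
  ∃ (t : ℕ) (φ : L.Formula (Fin 1 ⊕ Fin t)) (N : FirstOrder.Language.Theory.ModelType.{u, v, max u v w} T),
    WeakWideIn N φ

/-- `T` is strong wide: some formula is strong wide in some model of `T`. -/
def IsStrongWide : Prop :=
  ∃ (t : ℕ) (φ : L.Formula (Fin 1 ⊕ Fin t)) (N : FirstOrder.Language.Theory.ModelType.{u, v, max u v w} T),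
    StrongWideIn N φ

end Theories

end WideNIP

/-!
The proof rests on one combinatorial fact and one construction.

*Separation forces the independence property.* If the members of an infinite family of sets are
pairwise far apart, in the sense that for any finite set of pairs some point separates a fixed
proportion of them, then the family has infinite VC dimension
(`WideNIP.exists_shattered_of_separated`): choosing separating points greedily, logarithmically many
points distinguish many members, and the Sauer–Shelah lemma gives large shattered sets. The
translates of a wide set of integers are far apart in density (`WideNIP.IsWide.exists_shattered`), so
a weak wide formula has the independence property. In a noncompact system some set in the
generating algebra, that is, some instance `φ(M, c)`, has translates `φ(M, σⁿ c)` which are far apart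
in measure (`WideNIP.exists_separated_of_not_isCompactSystem`), so again `φ` has the independence
property.

*The independence property yields a wide orbit.* In the saturated model `M`, now infinite and hence
uncountable, the independence property descends to a formula `φ(x, y)` with `x` a single variable
(`WideNIP.HasIPIn.exists_singleton`), and for any prescribed `J ⊆ ℤ` there are an indiscernible
sequence `(aᵢ)` and a tuple `c` with `φ(aᵢ, c)` iff `i ∈ J`
(`WideNIP.HasIPIn.exists_indiscernible`). Indiscernibility comes from iterated ultrafilter
quantifiers rather than from Ramsey's theorem. For `J` take the Thue–Morse set, whose correlations
all exist and are at most `1 / 3` in absolute value (`WideNIP.exists_isWide`). A transfinite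
back-and-forth (`WideNIP.exists_automorphism`) extends `aᵢ ↦ aᵢ₊₁` to an automorphism `σ`, so `φ` is
strong wide in `M`. Averaging along the orbit gives a `σ`-invariant finitely additive measure on the
definable sets; by saturation a decreasing sequence of nonempty definable sets has a common point,
so this measure is a premeasure and extends to the generated σ-algebra
(`WideNIP.exists_measure_of_additive`), where the translates of `φ(M, c)` show that the system is not
compact.
-/

namespace WideNIP

open FirstOrder Filter Topology Cardinal MeasureTheory

/-! ### Separated families of sets shatter arbitrarily large finite sets -/

open Classical in
/-- Greedy separation: if some point always separates at least an `ε`-fraction of the pairs that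
remain, then `m` points leave at most a `(1 - ε) ^ m`-fraction of the pairs unseparated. -/
lemma exists_finset_few_unseparated {X : Type*} (D : ℕ → Set X) {ε : ℝ} (hε1 : ε ≤ 1)
    (hsep : ∀ P : Finset (ℕ × ℕ), (∀ p ∈ P, p.1 ≠ p.2) → P.Nonempty →
      ∃ x, ε * (P.card : ℝ) ≤ ((P.filter fun p => x ∈ symmDiff (D p.1) (D p.2)).card : ℝ))
    (P : Finset (ℕ × ℕ)) (hP : ∀ p ∈ P, p.1 ≠ p.2) (m : ℕ) :
    ∃ F : Finset X, F.card ≤ m ∧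
      ((P.filter fun p => ∀ x ∈ F, x ∉ symmDiff (D p.1) (D p.2)).card : ℝ)
        ≤ (1 - ε) ^ m * (P.card : ℝ) := by
  induction m with
  | zero => exact ⟨∅, by simp, by simp⟩
  | succ m ih =>
    obtain ⟨F, hF, hF'⟩ := ih
    set Q := P.filter fun p => ∀ x ∈ F, x ∉ symmDiff (D p.1) (D p.2) with hQ
    rcases Q.eq_empty_or_nonempty with h0 | hne
    · refine ⟨F, by omega, ?_⟩
      rw [← hQ, h0]
      have : 0 ≤ 1 - ε := by linarith
      simp only [Finset.card_empty, Nat.cast_zero]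
      positivity
    · obtain ⟨x, hx⟩ := hsep Q (fun p hp => hP p (Finset.mem_filter.1 hp).1) hne
      refine ⟨insert x F, (Finset.card_insert_le _ _).trans (by omega), ?_⟩
      have h1 : (P.filter fun p => ∀ z ∈ insert x F, z ∉ symmDiff (D p.1) (D p.2))
          = Q.filter fun p => ¬ x ∈ symmDiff (D p.1) (D p.2) := by
        rw [hQ, Finset.filter_filter]
        refine Finset.filter_congr fun p _ => ?_
        simp only [Finset.forall_mem_insert]
        tauto
      rw [h1]
      have h2 := Finset.card_filter_add_card_filter_not (s := Q)
        (fun p => x ∈ symmDiff (D p.1) (D p.2))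
      have h3 : ((Q.filter fun p => x ∈ symmDiff (D p.1) (D p.2)).card : ℝ) +
        ((Q.filter fun p => ¬ x ∈ symmDiff (D p.1) (D p.2)).card : ℝ) = Q.card := by
        exact_mod_cast h2
      have h4 : (0 : ℝ) ≤ 1 - ε := by linarith
      calc ((Q.filter fun p => ¬ x ∈ symmDiff (D p.1) (D p.2)).card : ℝ)
          ≤ (1 - ε) * Q.card := by linarith
        _ ≤ (1 - ε) * ((1 - ε) ^ m * (P.card : ℝ)) := by gcongr
        _ = _ := by ring

lemma exists_pow_mul_sq_lt_one {q : ℝ} (h0 : 0 ≤ q) (h1 : q < 1) (n : ℕ) :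
    ∃ m : ℕ, q ^ m * ((n : ℝ) * ((m : ℝ) + 1) ^ n + 1) ^ 2 < 1 := by
  rcases h0.eq_or_lt with rfl | hpos
  · exact ⟨1, by norm_num⟩
  have key : Tendsto (fun m : ℕ => ((m : ℝ) + 1) ^ (2 * n) * q ^ (m + 1)) atTop (𝓝 0) := by
    have := tendsto_pow_const_mul_const_pow_of_abs_lt_one (2 * n) (r := q)
      (by rw [abs_of_nonneg h0]; exact h1)
    refine ((tendsto_add_atTop_iff_nat 1).2 this).congr fun m => by push_cast; rfl
  have key2 : Tendsto (fun m : ℕ => (((n : ℝ) + 1) ^ 2 / q) *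
      (((m : ℝ) + 1) ^ (2 * n) * q ^ (m + 1))) atTop (𝓝 0) := by
    simpa using key.const_mul (((n : ℝ) + 1) ^ 2 / q)
  obtain ⟨m, hm⟩ := (key2.eventually (gt_mem_nhds one_pos)).exists
  refine ⟨m, lt_of_le_of_lt ?_ hm⟩
  have h2 : (n : ℝ) * ((m : ℝ) + 1) ^ n + 1 ≤ ((n : ℝ) + 1) * ((m : ℝ) + 1) ^ n := by
    have : (1 : ℝ) ≤ ((m : ℝ) + 1) ^ n := one_le_pow₀ (by linarith [Nat.cast_nonneg (α := ℝ) m])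
    linarith
  calc q ^ m * ((n : ℝ) * ((m : ℝ) + 1) ^ n + 1) ^ 2
      ≤ q ^ m * (((n : ℝ) + 1) * ((m : ℝ) + 1) ^ n) ^ 2 := by gcongr
    _ = _ := by field_simp; ring

open Classical in
/-- A finite set family with more than `n * (m + 1) ^ n` members on `m` points shatters a set with
`n` elements. -/
lemma exists_shatters_of_card {X : Type*} (n : ℕ) (F : Finset X) (𝒜 : Finset (Finset X))
    (hA : ∀ s ∈ 𝒜, s ⊆ F) (hc : n * (F.card + 1) ^ n < 𝒜.card) :
    ∃ s : Finset X, n ≤ s.card ∧ 𝒜.Shatters s := by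
  by_contra! hcon
  have hsub : 𝒜.shatterer ⊆ (Finset.range n).biUnion fun j => F.powersetCard j := by
    intro s hs
    rw [Finset.mem_shatterer] at hs
    obtain ⟨u, hu, hsu⟩ := hs.exists_superset
    have hlt : s.card < n := by
      by_contra h
      exact hcon s (not_lt.1 h) hs
    simp only [Finset.mem_biUnion, Finset.mem_range, Finset.mem_powersetCard]
    exact ⟨s.card, hlt, hsu.trans (hA u hu), rfl⟩
  have h1 := (𝒜.card_le_card_shatterer.trans (Finset.card_le_card hsub)).trans
    Finset.card_biUnion_le
  have h2 : ∑ j ∈ Finset.range n, (F.powersetCard j).card ≤ n * (F.card + 1) ^ n := by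
    calc ∑ j ∈ Finset.range n, (F.powersetCard j).card
        ≤ ∑ j ∈ Finset.range n, (F.card + 1) ^ n := by
          refine Finset.sum_le_sum fun j hj => ?_
          rw [Finset.card_powersetCard]
          calc F.card.choose j ≤ F.card ^ j := Nat.choose_le_pow _ _
            _ ≤ (F.card + 1) ^ j := Nat.pow_le_pow_left (by omega) _
            _ ≤ (F.card + 1) ^ n := Nat.pow_le_pow_right (by omega) (Finset.mem_range.1 hj).le
      _ = _ := by simp
  omega

open Classical in
/-- An infinite family of sets whose pairs are separated with frequency at least `ε` has infinite
VC dimension: a few greedily chosen points tell many members apart, and a finite family of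
traces that is larger than polynomial in the number of points shatters a large set. -/
lemma exists_shattered_of_separated {X : Type*} (D : ℕ → Set X) {ε : ℝ} (hε : 0 < ε)
    (hsep : ∀ P : Finset (ℕ × ℕ), (∀ p ∈ P, p.1 ≠ p.2) → P.Nonempty →
      ∃ x, ε * (P.card : ℝ) ≤ ((P.filter fun p => x ∈ symmDiff (D p.1) (D p.2)).card : ℝ))
    (n : ℕ) :
    ∃ x : Fin n → X, ∀ J : Set (Fin n), ∃ i, ∀ l, x l ∈ D i ↔ l ∈ J := by
  wlog hε1 : ε ≤ 1 generalizing ε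
  · refine this (ε := 1) one_pos (fun P h1 h2 => ?_) le_rfl
    obtain ⟨x, hx⟩ := hsep P h1 h2
    refine ⟨x, le_trans ?_ hx⟩
    gcongr
    exact (not_le.1 hε1).le
  obtain ⟨m, hm⟩ := exists_pow_mul_sq_lt_one (q := 1 - ε) (by linarith) (by linarith) n
  -- `k` members have fewer than `k ^ 2` pairs, so `m` points separate all of them, while `k` traces
  -- on `m` points are too many not to shatter `n` points
  set k := n * (m + 1) ^ n + 1 with hk
  obtain ⟨F, hFm, hF⟩ := exists_finset_few_unseparated D hε1 hsep (Finset.range k).offDiag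
    (fun p hp => (Finset.mem_offDiag.1 hp).2.2) m
  have hlt : (((Finset.range k).offDiag.filter
      fun p => ∀ x ∈ F, x ∉ symmDiff (D p.1) (D p.2)).card : ℝ) < 1 := by
    refine hF.trans_lt (lt_of_le_of_lt ?_ hm)
    have h0 : 0 ≤ 1 - ε := by linarith
    have : (((Finset.range k).offDiag.card : ℕ) : ℝ) ≤ ((n : ℝ) * ((m : ℝ) + 1) ^ n + 1) ^ 2 := by
      rw [Finset.offDiag_card, Finset.card_range]
      calc ((k * k - k : ℕ) : ℝ) ≤ ((k * k : ℕ) : ℝ) := by exact_mod_cast Nat.sub_le _ _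
        _ = _ := by rw [hk]; push_cast; ring
    gcongr
  have hzero : ((Finset.range k).offDiag.filter
      fun p => ∀ x ∈ F, x ∉ symmDiff (D p.1) (D p.2)) = ∅ := by
    rw [← Finset.card_eq_zero]
    have : ((Finset.range k).offDiag.filter
      fun p => ∀ x ∈ F, x ∉ symmDiff (D p.1) (D p.2)).card < 1 := by exact_mod_cast hlt
    omega
  set tr : ℕ → Finset X := fun i => F.filter fun x => x ∈ D i with htr
  have hinj : Set.InjOn tr (Finset.range k) := by
    intro i hi j hj hij
    by_contra hne
    have : (i, j) ∈ ((Finset.range k).offDiag.filter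
        fun p => ∀ x ∈ F, x ∉ symmDiff (D p.1) (D p.2)) := by
      rw [Finset.mem_filter, Finset.mem_offDiag]
      refine ⟨⟨hi, hj, hne⟩, fun x hx hxs => ?_⟩
      have h := congrArg (fun s => x ∈ s) hij
      simp only [htr, Finset.mem_filter, hx, true_and, eq_iff_iff] at h
      rw [Set.mem_symmDiff] at hxs
      tauto
    rw [hzero] at this
    simp at this
  obtain ⟨s, hns, hs⟩ := exists_shatters_of_card n F ((Finset.range k).image tr)
    (by
      intro t ht
      obtain ⟨i, -, rfl⟩ := Finset.mem_image.1 ht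
      exact Finset.filter_subset _ _)
    (by
      rw [Finset.card_image_of_injOn hinj, Finset.card_range, hk]
      have : n * (F.card + 1) ^ n ≤ n * (m + 1) ^ n :=
        Nat.mul_le_mul_left _ (Nat.pow_le_pow_left (by omega) _)
      omega)
  have hsF : s ⊆ F := by
    obtain ⟨u, hu, hsu⟩ := hs.exists_superset
    obtain ⟨i, -, rfl⟩ := Finset.mem_image.1 hu
    exact hsu.trans (Finset.filter_subset _ _)
  refine ⟨fun l => (s.equivFin.symm (Fin.castLE hns l) : X), fun J => ?_⟩
  obtain ⟨u, hu, hsu⟩ := hs (t := s.filter fun x =>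
    ∃ l ∈ J, (s.equivFin.symm (Fin.castLE hns l) : X) = x) (Finset.filter_subset _ _)
  obtain ⟨i, -, rfl⟩ := Finset.mem_image.1 hu
  refine ⟨i, fun l => ?_⟩
  have hl : (s.equivFin.symm (Fin.castLE hns l) : X) ∈ s := Subtype.coe_prop _
  have h := congrArg (fun t => (s.equivFin.symm (Fin.castLE hns l) : X) ∈ t) hsu
  simp only [Finset.mem_inter, hl, true_and, htr, Finset.mem_filter, hsF hl, eq_iff_iff,
    Subtype.coe_inj, EmbeddingLike.apply_eq_iff_eq] at h
  rw [h]
  constructor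
  · rintro ⟨l', hl', he⟩
    rwa [← Fin.castLE_injective hns he]
  · exact fun h => ⟨l, h, rfl⟩

/-! ### Densities of sets of integers -/

/-- The number of elements of `I` in `[-n, n]`. -/
noncomputable def symmCount (I : Set ℤ) (n : ℕ) : ℕ := (I ∩ Set.Icc (-(n : ℤ)) (n : ℤ)).ncard

lemma hasDensity_iff (I : Set ℤ) (d : ℝ) :
    HasDensity I d ↔ Tendsto (fun n : ℕ => (symmCount I n : ℝ) / (n : ℝ)) atTop (𝓝 d) := Iff.rfl

lemma mem_shift {n : ℤ} {I : Set ℤ} {x : ℤ} : x ∈ shift n I ↔ x - n ∈ I := by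
  constructor
  · rintro ⟨i, hi, rfl⟩
    simpa using hi
  · exact fun h => ⟨x - n, h, by simp⟩

lemma shift_shift (a b : ℤ) (I : Set ℤ) : shift a (shift b I) = shift (b + a) I := by
  ext x
  simp only [mem_shift]
  rw [show x - a - b = x - (b + a) by ring]

lemma shift_zero (I : Set ℤ) : shift 0 I = I := by
  ext x
  simp [mem_shift]

lemma finite_inter_Icc (I : Set ℤ) (a b : ℤ) : (I ∩ Set.Icc a b).Finite :=
  (Set.finite_Icc a b).subset Set.inter_subset_right

lemma symmCount_univ (n : ℕ) : symmCount Set.univ n = 2 * n + 1 := by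
  rw [symmCount, Set.univ_inter, ← Finset.coe_Icc, Set.ncard_coe_finset, Int.card_Icc]
  omega

lemma symmCount_mono {I J : Set ℤ} (h : I ⊆ J) (n : ℕ) : symmCount I n ≤ symmCount J n :=
  Set.ncard_le_ncard (Set.inter_subset_inter_left _ h) (finite_inter_Icc _ _ _)

lemma symmCount_union {I J : Set ℤ} (h : Disjoint I J) (n : ℕ) :
    symmCount (I ∪ J) n = symmCount I n + symmCount J n := by
  rw [symmCount, Set.union_inter_distrib_right]
  exact Set.ncard_union_eq (h.mono Set.inter_subset_left Set.inter_subset_left)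
    (finite_inter_Icc _ _ _) (finite_inter_Icc _ _ _)

lemma symmCount_symmDiff (I J : Set ℤ) (n : ℕ) :
    symmCount (symmDiff I J) n + 2 * symmCount (I ∩ J) n = symmCount I n + symmCount J n := by
  have h1 : symmCount I n = symmCount (I \ J) n + symmCount (I ∩ J) n := by
    rw [← symmCount_union (Set.disjoint_sdiff_inter), Set.sdiff_union_inter]
  have h2 : symmCount J n = symmCount (J \ I) n + symmCount (I ∩ J) n := by
    rw [Set.inter_comm, ← symmCount_union (Set.disjoint_sdiff_inter), Set.sdiff_union_inter]
  have h3 : symmCount (symmDiff I J) n = symmCount (I \ J) n + symmCount (J \ I) n := by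
    rw [← symmCount_union disjoint_sdiff_sdiff]
    rfl
  omega

lemma symmCount_add_le (I : Set ℤ) (n j : ℕ) : symmCount I (n + j) ≤ symmCount I n + 2 * j := by
  have hsub : I ∩ Set.Icc (-((n + j : ℕ) : ℤ)) ((n + j : ℕ) : ℤ) ⊆
      (I ∩ Set.Icc (-(n : ℤ)) (n : ℤ)) ∪
        (((Finset.Icc (-(n : ℤ) - j) (-n - 1) ∪ Finset.Icc ((n : ℤ) + 1) (n + j) :
          Finset ℤ)) : Set ℤ) := by
    intro x hx
    simp only [Set.mem_inter_iff, Set.mem_Icc, Set.mem_union, Finset.coe_union, Finset.coe_Icc,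
      Nat.cast_add] at hx ⊢
    by_cases h1 : -(n : ℤ) ≤ x
    · by_cases h2 : x ≤ n
      · exact Or.inl ⟨hx.1, h1, h2⟩
      · exact Or.inr (Or.inr ⟨by omega, hx.2.2⟩)
    · exact Or.inr (Or.inl ⟨by omega, by omega⟩)
  refine (Set.ncard_le_ncard hsub ((finite_inter_Icc _ _ _).union (Finset.finite_toSet _))).trans
    ((Set.ncard_union_le _ _).trans ?_)
  rw [Set.ncard_coe_finset]
  have := Finset.card_union_le (Finset.Icc (-(n : ℤ) - j) (-n - 1)) (Finset.Icc ((n : ℤ) + 1) (n + j))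
  rw [Int.card_Icc, Int.card_Icc] at this
  have h2 : symmCount I n = (I ∩ Set.Icc (-(n : ℤ)) (n : ℤ)).ncard := rfl
  omega

lemma symmCount_shift_le (I : Set ℤ) (k : ℤ) (n : ℕ) :
    symmCount (shift k I) n ≤ symmCount I n + 2 * k.natAbs := by
  refine le_trans ?_ (symmCount_add_le I n k.natAbs)
  have hsub : shift k I ∩ Set.Icc (-(n : ℤ)) (n : ℤ) ⊆
      (fun i => i + k) '' (I ∩ Set.Icc (-((n + k.natAbs : ℕ) : ℤ)) ((n + k.natAbs : ℕ) : ℤ)) := by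
    rintro _ ⟨⟨i, hi, rfl⟩, h⟩
    simp only [Set.mem_Icc] at h
    refine ⟨i, ⟨hi, ?_⟩, rfl⟩
    simp only [Set.mem_Icc]
    omega
  exact (Set.ncard_le_ncard hsub ((finite_inter_Icc _ _ _).image _)).trans
    (Set.ncard_image_le (finite_inter_Icc _ _ _))

lemma abs_symmCount_shift_sub_le (I : Set ℤ) (k : ℤ) (n : ℕ) :
    |(symmCount (shift k I) n : ℝ) - symmCount I n| ≤ 2 * (k.natAbs : ℝ) := by
  have h1 := symmCount_shift_le I k n
  have h2 := symmCount_shift_le (shift k I) (-k) n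
  rw [shift_shift, add_neg_cancel, shift_zero, Int.natAbs_neg] at h2
  have h1' : (symmCount (shift k I) n : ℝ) ≤ symmCount I n + 2 * k.natAbs := by exact_mod_cast h1
  have h2' : (symmCount I n : ℝ) ≤ symmCount (shift k I) n + 2 * k.natAbs := by exact_mod_cast h2
  rw [abs_le]
  constructor <;> linarith

/-- A bounded perturbation does not change a limit of averages, along any filter finer than
`atTop`. -/
lemma tendsto_div_of_abs_sub_le {f g : ℕ → ℝ} {C d : ℝ} (h : ∀ n, |g n - f n| ≤ C)
    {s : ℕ → ℝ} (hs : Tendsto s atTop atTop) {l : Filter ℕ} (hl : l ≤ atTop)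
    (hf : Tendsto (fun n => f n / s n) l (𝓝 d)) : Tendsto (fun n => g n / s n) l (𝓝 d) := by
  have hz : Tendsto (fun n => (g n - f n) / s n) l (𝓝 0) := by
    have h0 : Tendsto (fun n => C / s n) l (𝓝 0) := (hs.mono_left hl).const_div_atTop C
    refine squeeze_zero_norm' ?_ h0
    filter_upwards [hl (hs.eventually_gt_atTop 0)] with n hn
    rw [norm_div, Real.norm_eq_abs, Real.norm_eq_abs, abs_of_pos hn]
    gcongr
    exact h n
  simpa [← add_div] using hf.add hz

lemma HasDensity.shift {I : Set ℤ} {d : ℝ} (h : HasDensity I d) (k : ℤ) :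
    HasDensity (shift k I) d :=
  tendsto_div_of_abs_sub_le (abs_symmCount_shift_sub_le I k) tendsto_natCast_atTop_atTop le_rfl h

lemma HasDensity.symmDiff {I J : Set ℤ} {a b c : ℝ} (hI : HasDensity I a) (hJ : HasDensity J b)
    (hIJ : HasDensity (I ∩ J) c) : HasDensity (symmDiff I J) (a + b - 2 * c) := by
  rw [hasDensity_iff] at *
  refine ((hI.add hJ).sub (hIJ.const_mul 2)).congr fun n => ?_
  have h : (symmCount (_root_.symmDiff I J) n : ℝ) + 2 * symmCount (I ∩ J) n
    = symmCount I n + symmCount J n := by exact_mod_cast symmCount_symmDiff I J n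
  rw [← add_div, ← h]
  ring

/-- Distinct translates of an `ε`-wide set differ by a set of density at least `2 ε`. -/
lemma IsWide.exists_hasDensity_symmDiff {ε : ℝ} {I : Set ℤ} (h : IsWide ε I) {i j : ℤ}
    (hij : i ≠ j) : ∃ r : ℝ, 2 * ε ≤ r ∧ HasDensity (symmDiff (shift i I) (shift j I)) r := by
  obtain ⟨d, hd, H⟩ := h
  obtain ⟨d', hd', hle⟩ := H (j - i) (sub_ne_zero.2 hij.symm)
  refine ⟨d + d - 2 * d', by linarith, (hd.shift i).symmDiff (hd.shift j) ?_⟩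
  convert hd'.shift i using 1
  ext x
  simp only [Set.mem_inter_iff, mem_shift]
  rw [show x - i - (j - i) = x - j by ring]

/-- The translates of a wide set shatter finite sets of every size. -/
lemma IsWide.exists_shattered {ε : ℝ} (hε : 0 < ε) {I : Set ℤ} (h : IsWide ε I) (n : ℕ) :
    ∃ x : Fin n → ℤ, ∀ J : Set (Fin n), ∃ i : ℕ, ∀ l, x l - i ∈ I ↔ l ∈ J := by
  have := exists_shattered_of_separated (fun i : ℕ => WideNIP.shift (i : ℤ) I)
    (ε := ε / 3) (by positivity) ?_ n
  · simpa only [mem_shift] using this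
  classical
  intro P hP hne
  have hev : ∀ᶠ N : ℕ in atTop, ∀ p ∈ P,
      ε ≤ (symmCount (symmDiff (WideNIP.shift (p.1 : ℤ) I) (WideNIP.shift (p.2 : ℤ) I)) N : ℝ)
        / N := by
    rw [Filter.eventually_all_finset]
    intro p hp
    obtain ⟨r, hr, hd⟩ := h.exists_hasDensity_symmDiff
      (show ((p.1 : ℤ)) ≠ (p.2 : ℤ) by exact_mod_cast hP p hp)
    exact (hd.eventually (lt_mem_nhds (show ε < r by linarith))).mono fun _ h => h.le
  obtain ⟨N, hN, hN1⟩ := (hev.and (eventually_ge_atTop 1)).exists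
  have hN0 : (0 : ℝ) < N := by exact_mod_cast hN1
  by_contra! hcon
  -- double counting of the pairs `(x, p)` with `x ∈ [-N, N]` separating `p`; the factor `1 / 3` is
  -- there because `[-N, N]` has up to `3 N` elements
  have hswap := Finset.sum_card_bipartiteAbove_eq_sum_card_bipartiteBelow
    (s := Finset.Icc (-(N : ℤ)) N) (t := P)
    (fun x p => x ∈ symmDiff (WideNIP.shift (p.1 : ℤ) I) (WideNIP.shift (p.2 : ℤ) I))
  have hlow : ∀ p ∈ P, ε * N ≤ ((Finset.bipartiteBelow (fun (x : ℤ) (p : ℕ × ℕ) => x ∈ symmDiff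
      (WideNIP.shift (p.1 : ℤ) I) (WideNIP.shift (p.2 : ℤ) I))
      (Finset.Icc (-(N : ℤ)) N) p).card : ℝ) := by
    intro p hp
    have h1 := hN p hp
    rw [le_div_iff₀ hN0] at h1
    refine h1.trans (le_of_eq ?_)
    rw [symmCount, ← Set.ncard_coe_finset]
    congr 2
    ext x
    simp [Finset.bipartiteBelow, and_comm]
  have hup : ∀ x ∈ Finset.Icc (-(N : ℤ)) N, ((Finset.bipartiteAbove (fun (x : ℤ) (p : ℕ × ℕ) =>
      x ∈ symmDiff (WideNIP.shift (p.1 : ℤ) I) (WideNIP.shift (p.2 : ℤ) I)) P x).card : ℝ)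
      < ε / 3 * P.card := fun x _ => hcon x
  have h1 := Finset.sum_le_sum hlow
  have h2 := Finset.sum_lt_sum_of_nonempty (s := Finset.Icc (-(N : ℤ)) N) ⟨0, by simp⟩ hup
  have h3 : ((∑ x ∈ Finset.Icc (-(N : ℤ)) N, (Finset.bipartiteAbove (fun (x : ℤ) (p : ℕ × ℕ) =>
      x ∈ symmDiff (WideNIP.shift (p.1 : ℤ) I) (WideNIP.shift (p.2 : ℤ) I)) P x).card : ℕ) : ℝ)
      = ((∑ p ∈ P, (Finset.bipartiteBelow (fun (x : ℤ) (p : ℕ × ℕ) =>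
      x ∈ symmDiff (WideNIP.shift (p.1 : ℤ) I) (WideNIP.shift (p.2 : ℤ) I))
        (Finset.Icc (-(N : ℤ)) N) p).card : ℕ) : ℝ) := by
    exact_mod_cast hswap
  push_cast at h3
  rw [h3] at h2
  have h4 := h1.trans_lt h2
  have hcard : (Finset.Icc (-(N : ℤ)) N).card = 2 * N + 1 := by
    rw [Int.card_Icc]; omega
  rw [Finset.sum_const, Finset.sum_const, hcard, nsmul_eq_mul, nsmul_eq_mul] at h4
  push_cast at h4
  have hP0 : (0 : ℝ) < P.card := by exact_mod_cast hne.card_pos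
  have hN2 : (1 : ℝ) ≤ N := by exact_mod_cast hN1
  have : (2 * (N : ℝ) + 1) * (ε / 3 * P.card) ≤ P.card * (ε * N) := by
    have h5 : (2 * (N : ℝ) + 1) ≤ 3 * N := by linarith
    calc (2 * (N : ℝ) + 1) * (ε / 3 * P.card) ≤ (3 * N) * (ε / 3 * P.card) := by gcongr
      _ = _ := by ring
  linarith

/-- There is a translation-invariant finitely additive probability on all sets of integers, equal
to half of the density wherever the latter exists: an ultrafilter limit of relative frequencies in
`[-n, n]`, an interval of `2 n + 1` integers. -/
lemma exists_invariant_mean : ∃ m : Set ℤ → ℝ, (∀ I, 0 ≤ m I) ∧ m Set.univ = 1 ∧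
    (∀ I J, Disjoint I J → m (I ∪ J) = m I + m J) ∧ (∀ k I, m (shift k I) = m I) ∧
    ∀ I d, HasDensity I d → m I = d / 2 := by
  set U : Ultrafilter ℕ := hyperfilter ℕ
  have hU : (U : Filter ℕ) ≤ atTop := by
    rw [← Nat.cofinite_eq_atTop]
    exact hyperfilter_le_cofinite
  have hs : Tendsto (fun n : ℕ => 2 * (n : ℝ) + 1) atTop atTop :=
    tendsto_atTop_add_const_right _ _
      (tendsto_natCast_atTop_atTop.const_mul_atTop two_pos)
  have hex : ∀ I : Set ℤ, ∃ x : ℝ,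
      Tendsto (fun n : ℕ => (symmCount I n : ℝ) / (2 * n + 1)) U (𝓝 x) := by
    intro I
    have hmem : ∀ n : ℕ, (symmCount I n : ℝ) / (2 * n + 1) ∈ Set.Icc (0 : ℝ) 1 := by
      intro n
      refine ⟨by positivity, ?_⟩
      rw [div_le_one (by positivity)]
      have := symmCount_mono (Set.subset_univ I) n
      rw [symmCount_univ] at this
      exact_mod_cast this
    obtain ⟨x, -, hx⟩ := isCompact_Icc.ultrafilter_le_nhds
      (U.map fun n : ℕ => (symmCount I n : ℝ) / (2 * n + 1)) (by
        rw [Ultrafilter.coe_map, le_principal_iff]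
        exact Filter.mem_map.2 (Filter.univ_mem' hmem))
    exact ⟨x, hx⟩
  choose m hm using hex
  refine ⟨m, fun I => ?_, ?_, fun I J h => ?_, fun k I => ?_, fun I d h => ?_⟩
  · exact ge_of_tendsto' (hm I) fun n => by positivity
  · refine tendsto_nhds_unique (hm _) (tendsto_const_nhds.congr fun n => ?_)
    rw [symmCount_univ]
    push_cast
    rw [div_self (by positivity)]
  · refine tendsto_nhds_unique (hm _) (((hm I).add (hm J)).congr fun n => ?_)
    rw [symmCount_union h]
    push_cast
    ring
  · exact tendsto_nhds_unique (hm _)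
      (tendsto_div_of_abs_sub_le (abs_symmCount_shift_sub_le I k) hs hU (hm I))
  · refine tendsto_nhds_unique (hm _) ?_
    have h1 : Tendsto (fun n : ℕ => (symmCount I n : ℝ) / n * ((n : ℝ) / (2 * n + 1))) U
        (𝓝 (d * (1 / 2))) := by
      refine (h.mono_left hU).mul (Tendsto.mono_left ?_ hU)
      have h2 : Tendsto (fun n : ℕ => (1 / 2 : ℝ) - (1 / 2) / (2 * n + 1)) atTop (𝓝 (1 / 2 - 0)) :=
        tendsto_const_nhds.sub (hs.const_div_atTop _)
      rw [sub_zero] at h2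
      refine h2.congr fun n => ?_
      have : (2 * (n : ℝ) + 1) ≠ 0 := by positivity
      field_simp
      ring
    rw [show d / 2 = d * (1 / 2) by ring]
    refine h1.congr' ?_
    filter_upwards [hU (eventually_gt_atTop 0)] with n hn
    have : (n : ℝ) ≠ 0 := by exact_mod_cast hn.ne'
    field_simp

/-! ### The Thue–Morse sequence is wide -/

/-- The Thue–Morse sequence with values `± 1`: the parity of the binary digit sum. -/
noncomputable def thueMorse (n : ℕ) : ℝ := (-1) ^ (Nat.digits 2 n).sum

lemma thueMorse_two_mul (n : ℕ) : thueMorse (2 * n) = thueMorse n := by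
  rcases n.eq_zero_or_pos with rfl | h
  · simp
  · rw [thueMorse, thueMorse, Nat.digits_def' one_lt_two (by omega)]
    simp

lemma thueMorse_two_mul_add_one (n : ℕ) : thueMorse (2 * n + 1) = -thueMorse n := by
  rw [thueMorse, thueMorse, Nat.digits_def' one_lt_two (by omega)]
  have h1 : (2 * n + 1) % 2 = 1 := by omega
  have h2 : (2 * n + 1) / 2 = n := by omega
  rw [h1, h2, List.sum_cons, pow_add]
  ring

lemma thueMorse_eq_or (n : ℕ) : thueMorse n = 1 ∨ thueMorse n = -1 := neg_one_pow_eq_or ℝ _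

lemma thueMorse_sq (n : ℕ) : thueMorse n * thueMorse n = 1 := by
  rcases thueMorse_eq_or n with h | h <;> rw [h] <;> norm_num

lemma abs_thueMorse (n : ℕ) : |thueMorse n| = 1 := by
  rcases thueMorse_eq_or n with h | h <;> rw [h] <;> norm_num

/-- The correlation sum `∑_{i < N} t(i) t(i + k)` of the Thue–Morse sequence. -/
noncomputable def correlation (k N : ℕ) : ℝ :=
  ∑ i ∈ Finset.range N, thueMorse i * thueMorse (i + k)

lemma sum_range_two_mul (f : ℕ → ℝ) (N : ℕ) :
    ∑ i ∈ Finset.range (2 * N), f i = ∑ i ∈ Finset.range N, (f (2 * i) + f (2 * i + 1)) := by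
  induction N with
  | zero => simp
  | succ N ih =>
    rw [show 2 * (N + 1) = 2 * N + 1 + 1 by ring, Finset.sum_range_succ, Finset.sum_range_succ, ih,
      Finset.sum_range_succ]
    ring

lemma correlation_even (k N : ℕ) : correlation (2 * k) (2 * N) = 2 * correlation k N := by
  rw [correlation, sum_range_two_mul, correlation, Finset.mul_sum]
  refine Finset.sum_congr rfl fun i _ => ?_
  rw [show 2 * i + 2 * k = 2 * (i + k) by ring, show 2 * i + 1 + 2 * k = 2 * (i + k) + 1 by ring,
    thueMorse_two_mul, thueMorse_two_mul, thueMorse_two_mul_add_one, thueMorse_two_mul_add_one]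
  ring

lemma correlation_odd (k N : ℕ) :
    correlation (2 * k + 1) (2 * N) = -(correlation k N + correlation (k + 1) N) := by
  rw [correlation, sum_range_two_mul, correlation, correlation, ← Finset.sum_add_distrib,
    ← Finset.sum_neg_distrib]
  refine Finset.sum_congr rfl fun i _ => ?_
  rw [show 2 * i + (2 * k + 1) = 2 * (i + k) + 1 by ring,
    show 2 * i + 1 + (2 * k + 1) = 2 * (i + (k + 1)) by ring,
    thueMorse_two_mul, thueMorse_two_mul, thueMorse_two_mul_add_one, thueMorse_two_mul_add_one]
  ring

lemma correlation_zero (N : ℕ) : correlation 0 N = N := by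
  simp [correlation, thueMorse_sq]

lemma abs_correlation_succ_sub (k N : ℕ) : |correlation k (N + 1) - correlation k N| ≤ 1 := by
  rw [correlation, correlation, Finset.sum_range_succ, add_sub_cancel_left, abs_mul,
    abs_thueMorse, abs_thueMorse, one_mul]

/-- For sequences with bounded increments, averages along the even numbers determine all. -/
lemma tendsto_div_of_even {f : ℕ → ℝ} {C x : ℝ} (hf : ∀ n, |f (n + 1) - f n| ≤ C)
    (h : Tendsto (fun n : ℕ => f (2 * n) / n) atTop (𝓝 (2 * x))) :
    Tendsto (fun n : ℕ => f n / n) atTop (𝓝 x) := by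
  have hC : 0 ≤ C := (abs_nonneg _).trans (hf 0)
  have hdiv : Tendsto (fun n : ℕ => n / 2) atTop atTop :=
    Nat.tendsto_div_const_atTop two_ne_zero
  have h1 : Tendsto (fun n : ℕ => f (2 * (n / 2)) / ((n / 2 : ℕ) : ℝ)) atTop (𝓝 (2 * x)) :=
    h.comp hdiv
  have h2 : Tendsto (fun n : ℕ => ((n / 2 : ℕ) : ℝ) / n) atTop (𝓝 (1 / 2)) := by
    have h3 : Tendsto (fun n : ℕ => ((n : ℝ) / 2) / n) atTop (𝓝 (1 / 2)) := by
      refine tendsto_const_nhds.congr' ?_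
      filter_upwards [eventually_gt_atTop 0] with n hn
      have : (n : ℝ) ≠ 0 := by exact_mod_cast hn.ne'
      field_simp
    refine tendsto_div_of_abs_sub_le (C := 1) (fun n => ?_) tendsto_natCast_atTop_atTop le_rfl h3
    rcases Nat.even_or_odd' n with ⟨m, rfl | rfl⟩
    · rw [Nat.mul_div_cancel_left _ two_pos]
      push_cast
      rw [abs_le]; constructor <;> linarith
    · rw [show (2 * m + 1) / 2 = m by omega]
      push_cast
      rw [abs_le]; constructor <;> linarith
  have h4 : Tendsto (fun n : ℕ => f (2 * (n / 2)) / n) atTop (𝓝 x) := by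
    have h5 := h1.mul h2
    rw [show 2 * x * (1 / 2) = x by ring] at h5
    refine h5.congr' ?_
    filter_upwards [eventually_ge_atTop 2] with n hn
    have : ((n / 2 : ℕ) : ℝ) ≠ 0 := by
      have : n / 2 ≠ 0 := by omega
      exact_mod_cast this
    field_simp
  refine tendsto_div_of_abs_sub_le (C := C) (fun n => ?_) tendsto_natCast_atTop_atTop le_rfl h4
  rcases Nat.even_or_odd' n with ⟨m, rfl | rfl⟩
  · rw [Nat.mul_div_cancel_left _ two_pos, sub_self, abs_zero]
    exact hC
  · rw [show (2 * m + 1) / 2 = m by omega]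
    exact hf _

/-- The defect of the first correlation from its limit changes sign under doubling, so it grows
at most logarithmically. -/
lemma abs_correlation_one_add_le (N : ℕ) :
    |correlation 1 N + N / 3| ≤ 4 / 3 * (Nat.log 2 N + 1 : ℕ) := by
  induction N using Nat.strong_induction_on with
  | _ N ih =>
    have hdouble : ∀ m : ℕ, correlation 1 (2 * m) + (2 * m : ℕ) / 3 = -(correlation 1 m + m / 3) := by
      intro m
      have := correlation_odd 0 m
      rw [mul_zero, zero_add, correlation_zero] at this
      rw [this]
      push_cast
      ring
    by_cases hN : N < 2
    · interval_cases N
      · simp only [correlation, Finset.range_zero, Finset.sum_empty]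
        norm_num
      · have h1 : thueMorse 1 = -1 := by simp [thueMorse]
        have h0 : thueMorse 0 = 1 := by simp [thueMorse]
        simp only [correlation, Finset.range_one, Finset.sum_singleton, zero_add, h0, h1]
        norm_num
    · have hlog : Nat.log 2 N = Nat.log 2 (N / 2) + 1 :=
        Nat.log_of_one_lt_of_le one_lt_two (by omega)
      have hi := ih (N / 2) (by omega)
      rw [hlog]
      push_cast at hi ⊢
      rcases Nat.even_or_odd' N with ⟨m, rfl | rfl⟩
      · rw [Nat.mul_div_cancel_left _ two_pos] at hi ⊢
        rw [hdouble m, abs_neg]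
        linarith
      · rw [show (2 * m + 1) / 2 = m by omega] at hi ⊢
        have h1 := abs_correlation_succ_sub 1 (2 * m)
        have h2 := hdouble m
        push_cast at h2 ⊢
        have h3 : correlation 1 (2 * m + 1) + (2 * (m : ℝ) + 1) / 3 =
            (correlation 1 (2 * m + 1) - correlation 1 (2 * m)) + 1 / 3
              + -(correlation 1 m + m / 3) := by
          rw [← h2]; ring
        rw [h3]
        refine (abs_add_le _ _).trans ?_
        rw [abs_neg]
        have h4 := abs_add_le (correlation 1 (2 * m + 1) - correlation 1 (2 * m)) (1 / 3)
        rw [abs_of_pos (show (0 : ℝ) < 1 / 3 by norm_num)] at h4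
        linarith

lemma tendsto_correlation_one :
    Tendsto (fun n : ℕ => correlation 1 n / n) atTop (𝓝 (-1 / 3)) := by
  have h0 : Tendsto (fun n : ℕ => (4 / 3 * (Nat.log 2 n + 1 : ℕ) : ℝ) / n) atTop (𝓝 0) := by
    have hlog : Tendsto (fun n : ℕ => (Nat.log 2 n : ℝ) / n) atTop (𝓝 0) := by
      have h1 : Tendsto (fun n : ℕ => Real.log n / n * (1 / Real.log 2)) atTop (𝓝 0) := by
        have h2 := (Real.isLittleO_log_id_atTop.tendsto_div_nhds_zero).comp
          (tendsto_natCast_atTop_atTop (R := ℝ))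
        simpa using h2.mul_const (1 / Real.log 2)
      refine squeeze_zero (fun n => by positivity) (fun n => ?_) h1
      have h3 := Real.natLog_le_logb n 2
      calc (Nat.log 2 n : ℝ) / n ≤ Real.logb (2 : ℕ) n / n := by gcongr
        _ = _ := by rw [Real.logb]; push_cast; ring
    have h1 := (hlog.add tendsto_one_div_atTop_nhds_zero_nat).const_mul (4 / 3)
    rw [add_zero, mul_zero] at h1
    refine h1.congr fun n => ?_
    push_cast
    ring
  have h1 : Tendsto (fun n : ℕ => (correlation 1 n + n / 3) / n) atTop (𝓝 0) := by
    refine squeeze_zero_norm (fun n => ?_) h0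
    rw [norm_div, Real.norm_eq_abs, Real.norm_natCast]
    gcongr
    exact abs_correlation_one_add_le n
  have h2 := h1.sub_const (1 / 3)
  rw [show (0 : ℝ) - 1 / 3 = -1 / 3 by norm_num] at h2
  refine h2.congr' ?_
  filter_upwards [eventually_gt_atTop 0] with n hn
  have : (n : ℝ) ≠ 0 := by exact_mod_cast hn.ne'
  field_simp
  ring

/-- All correlations of the Thue–Morse sequence exist, and the nontrivial ones have absolute value
at most `1 / 3`. -/
lemma exists_tendsto_correlation (k : ℕ) (hk : 1 ≤ k) :
    ∃ η : ℝ, |η| ≤ 1 / 3 ∧ Tendsto (fun n : ℕ => correlation k n / n) atTop (𝓝 η) := by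
  induction k using Nat.strong_induction_on with
  | _ k ih =>
    rcases Nat.even_or_odd' k with ⟨j, rfl | rfl⟩
    · obtain ⟨η, h1, h2⟩ := ih j (by omega) (by omega)
      refine ⟨η, h1, tendsto_div_of_even (abs_correlation_succ_sub _) ?_⟩
      refine (h2.const_mul 2).congr fun n => ?_
      rw [correlation_even, mul_div_assoc]
    · rcases j.eq_zero_or_pos with rfl | hj
      · exact ⟨-1 / 3, by norm_num [abs_div], tendsto_correlation_one⟩
      · obtain ⟨η, h1, h2⟩ := ih j (by omega) hj
        obtain ⟨θ, h3, h4⟩ := ih (j + 1) (by omega) (by omega)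
        refine ⟨-(η + θ) / 2, ?_, tendsto_div_of_even (abs_correlation_succ_sub _) ?_⟩
        · rw [abs_le] at *
          constructor <;> linarith
        · rw [show 2 * (-(η + θ) / 2) = -(η + θ) by ring]
          refine (h2.add h4).neg.congr fun n => ?_
          rw [correlation_odd, ← add_div, neg_div]

/-- The set of natural numbers satisfying `p`, as a set of integers. -/
def natSet (p : ℕ → Prop) : Set ℤ := {x | ∃ n : ℕ, (n : ℤ) = x ∧ p n}

lemma symmCount_natSet (p : ℕ → Prop) [DecidablePred p] (N : ℕ) :
    symmCount (natSet p) N = ((Finset.range (N + 1)).filter p).card := by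
  rw [symmCount, ← Set.ncard_coe_finset,
    ← Set.ncard_image_of_injective _ (Nat.cast_injective (R := ℤ))]
  congr 1
  ext x
  simp only [natSet, Set.mem_inter_iff, Set.mem_ofPred_eq, Set.mem_Icc, Set.mem_image,
    Finset.coe_filter, Finset.mem_range]
  constructor
  · rintro ⟨⟨n, rfl, hn⟩, h1, h2⟩
    exact ⟨n, ⟨by omega, hn⟩, rfl⟩
  · rintro ⟨n, ⟨h1, h2⟩, rfl⟩
    exact ⟨⟨n, rfl, h2⟩, by omega, by omega⟩

lemma abs_sum_thueMorse_le (N : ℕ) : |∑ i ∈ Finset.range N, thueMorse i| ≤ 1 := by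
  have heven : ∀ m, ∑ i ∈ Finset.range (2 * m), thueMorse i = 0 := by
    intro m
    rw [sum_range_two_mul]
    exact Finset.sum_eq_zero fun i _ => by
      rw [thueMorse_two_mul, thueMorse_two_mul_add_one, add_neg_cancel]
  rcases Nat.even_or_odd' N with ⟨m, rfl | rfl⟩
  · rw [heven]; simp
  · rw [Finset.sum_range_succ, heven, zero_add, abs_thueMorse]

/-- Densities of the pair patterns of the Thue–Morse sequence in terms of its correlations. -/
lemma hasDensity_natSet_thueMorse {k : ℕ} {η : ℝ}
    (h : Tendsto (fun n : ℕ => correlation k n / n) atTop (𝓝 η)) :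
    HasDensity (natSet fun n => thueMorse n = 1 ∧ thueMorse (n + k) = 1) ((1 + η) / 4) := by
  classical
  have h1 : Tendsto (fun n : ℕ => ((n : ℝ) + correlation k n) / 4 / n) atTop
      (𝓝 ((1 + η) / 4)) := by
    refine ((h.const_add 1).div_const 4).congr' ?_
    filter_upwards [eventually_gt_atTop 0] with n hn
    have : (n : ℝ) ≠ 0 := by exact_mod_cast hn.ne'
    field_simp
  rw [hasDensity_iff]
  refine tendsto_div_of_abs_sub_le (C := 2 + k) (fun n => ?_) tendsto_natCast_atTop_atTop le_rfl h1
  have hind : ∀ i, (if thueMorse i = 1 ∧ thueMorse (i + k) = 1 then (1 : ℝ) else 0) =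
      (1 + thueMorse i + thueMorse (i + k) + thueMorse i * thueMorse (i + k)) / 4 := by
    intro i
    rcases thueMorse_eq_or i with h1 | h1 <;> rcases thueMorse_eq_or (i + k) with h2 | h2 <;>
      rw [h1, h2] <;> norm_num
  have hcard : (symmCount (natSet fun n => thueMorse n = 1 ∧ thueMorse (n + k) = 1) n : ℝ) =
      (((n : ℝ) + 1) + ∑ i ∈ Finset.range (n + 1), thueMorse i
        + ∑ i ∈ Finset.range (n + 1), thueMorse (i + k) + correlation k (n + 1)) / 4 := by
    rw [symmCount_natSet, Finset.card_filter]
    push_cast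
    rw [Finset.sum_congr rfl fun i _ => hind i, ← Finset.sum_div, Finset.sum_add_distrib,
      Finset.sum_add_distrib, Finset.sum_add_distrib, correlation]
    simp
  have hshift : ∑ i ∈ Finset.range (n + 1), thueMorse (i + k) =
      ∑ i ∈ Finset.range (k + (n + 1)), thueMorse i - ∑ i ∈ Finset.range k, thueMorse i := by
    rw [Finset.sum_range_add _ k, add_sub_cancel_left]
    exact Finset.sum_congr rfl fun i _ => by rw [add_comm]
  rw [hcard, hshift]
  have a1 := abs_le.1 (abs_sum_thueMorse_le (n + 1))
  have a2 := abs_le.1 (abs_sum_thueMorse_le (k + (n + 1)))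
  have a3 := abs_le.1 (abs_sum_thueMorse_le k)
  have a4 := abs_le.1 (abs_correlation_succ_sub k n)
  have a5 : (0 : ℝ) ≤ k := Nat.cast_nonneg k
  rw [abs_le]
  constructor <;> linarith

/-- The positions of `1` in the one-sided Thue–Morse sequence form a wide set of integers. -/
lemma exists_isWide : ∃ (J : Set ℤ) (ε : ℝ), 0 < ε ∧ IsWide ε J := by
  set J := natSet fun n => thueMorse n = 1 ∧ thueMorse (n + 0) = 1 with hJ
  have hmem : ∀ n : ℕ, (n : ℤ) ∈ J ↔ thueMorse n = 1 := by
    intro n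
    simp [hJ, natSet]
  have hnonneg : ∀ x ∈ J, 0 ≤ x := by
    rintro _ ⟨n, rfl, -⟩
    omega
  have hd : HasDensity J (1 / 2) := by
    have := hasDensity_natSet_thueMorse (k := 0) (η := 1) (by
      refine tendsto_const_nhds.congr' ?_
      filter_upwards [eventually_gt_atTop 0] with n hn
      have : (n : ℝ) ≠ 0 := by exact_mod_cast hn.ne'
      rw [correlation_zero, div_self this])
    norm_num at this
    simpa [hJ] using this
  have hpos : ∀ k : ℕ, 1 ≤ k → ∃ d' : ℝ, HasDensity (J ∩ shift k J) d' ∧ 1 / 6 ≤ 1 / 2 - d' := by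
    intro k hk
    obtain ⟨η, h1, h2⟩ := exists_tendsto_correlation k hk
    refine ⟨(1 + η) / 4, ?_, by linarith [(abs_le.1 h1).2]⟩
    convert (hasDensity_natSet_thueMorse h2).shift k using 1
    ext x
    simp only [Set.mem_inter_iff, mem_shift]
    constructor
    · rintro ⟨h3, h4⟩
      have h5 := hnonneg _ h4
      lift x - k to ℕ using h5 with y hy
      have hx : x = ((y + k : ℕ) : ℤ) := by push_cast; omega
      rw [hx, hmem] at h3
      rw [hmem] at h4
      exact ⟨y, rfl, h4, h3⟩
    · rintro ⟨y, hy, h3, h4⟩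
      have hx : x = ((y + k : ℕ) : ℤ) := by push_cast; omega
      rw [← hy, hx, hmem, hmem]
      exact ⟨h4, h3⟩
  refine ⟨J, 1 / 6, by norm_num, 1 / 2, hd, fun n hn => ?_⟩
  obtain ⟨k, rfl | rfl⟩ := n.eq_nat_or_neg
  · exact hpos k (by omega)
  · obtain ⟨d', h1, h2⟩ := hpos k (by omega)
    refine ⟨d', ?_, h2⟩
    convert h1.shift (-k) using 1
    ext x
    simp only [Set.mem_inter_iff, mem_shift, sub_neg_eq_add, add_sub_cancel_right]
    exact and_comm

/-! ### Saturation and compactness -/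

section Saturation

open FirstOrder.Language

variable {L : FirstOrder.Language.{u, v}} {M : Type w} [L.Structure M]

/-- The sections of a formula at a tuple `v` are definable over the range of `v`. -/
lemma definable₁_section {β : Type*} (φ : L.Formula (β ⊕ Fin 1)) (v : β → M) {A : Set M}
    (hA : Set.range v ⊆ A) :
    A.Definable₁ L {m | φ.Realize (Sum.elim v fun _ => m)} := by
  rw [Set.Definable₁, Set.definable_iff_exists_formula_sum]
  refine ⟨φ.relabel (Sum.map (fun b => ⟨v b, hA ⟨b, rfl⟩⟩) id), ?_⟩
  ext x
  rw [Set.mem_ofPred_eq, Set.mem_ofPred_eq, Set.mem_ofPred_eq, Formula.realize_relabel]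
  refine iff_of_eq (congrArg _ ?_)
  ext (b | i)
  · rfl
  · simp [Subsingleton.elim i 0]

lemma definable₁_iff_exists_formula {A : Set M} {s : Set M} :
    A.Definable₁ L s ↔ ∃ φ : L[[A]].Formula (Fin 1), ∀ m, m ∈ s ↔ φ.Realize fun _ => m := by
  constructor
  · rintro ⟨φ, hφ⟩
    refine ⟨φ, fun m => ?_⟩
    have := congrArg (fun t => (fun _ => m) ∈ t) hφ
    simpa using this
  · rintro ⟨φ, hφ⟩
    refine ⟨φ, ?_⟩
    ext x
    rw [Set.mem_ofPred_eq, hφ, Set.mem_ofPred_eq]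
    refine iff_of_eq (congrArg _ ?_)
    ext i
    rw [Subsingleton.elim i 0]

/-- Saturation in terms of definable sets: a family of sets definable over few parameters which
has the finite intersection property has a common point. -/
lemma IsKSaturated.exists_mem_of_fip {κ : Cardinal.{w}} (hM : IsKSaturated L M κ) {A : Set M}
    (hA : #A < κ) {J : Type*} (s : J → Set M) (hs : ∀ j, A.Definable₁ L (s j))
    (hfip : ∀ G : Finset J, ∃ m, ∀ j ∈ G, m ∈ s j) : ∃ m, ∀ j, m ∈ s j := by
  classical
  choose φ hφ using fun j => definable₁_iff_exists_formula.1 (hs j)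
  obtain ⟨m, hm⟩ := hM A hA (Set.range φ) fun G hG => by
    choose g hg using hG
    obtain ⟨m, hm⟩ := hfip (G.attach.image fun ψ => g ψ.2)
    refine ⟨m, fun ψ hψ => ?_⟩
    have := (hφ _ _).1 (hm (g hψ) (Finset.mem_image.2 ⟨⟨ψ, hψ⟩, Finset.mem_attach _ _, rfl⟩))
    rwa [hg hψ] at this
  exact ⟨m, fun j => (hφ j m).2 (hm _ ⟨j, rfl⟩)⟩

open Classical in
/-- Projections of definable sets along an injective reindexing, with no finiteness assumption on
the index types: only the finitely many free variables have to be quantified. -/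
lemma exists_formula_proj [Nonempty M] {α γ : Type*} (φ : L.Formula α) {e : γ → α}
    (he : Function.Injective e) :
    ∃ ψ : L.Formula γ, ∀ u : γ → M, ψ.Realize u ↔ ∃ w : α → M, w ∘ e = u ∧ φ.Realize w := by
  let f : φ.freeVarFinset → γ ⊕ φ.freeVarFinset := fun a =>
    if h : ∃ c, e c = a then Sum.inl h.choose else Sum.inr a
  have hf1 : ∀ (a : φ.freeVarFinset) (c : γ), e c = a → f a = Sum.inl c := by
    intro a c hc
    have h : ∃ c, e c = a := ⟨c, hc⟩
    simp only [f, dif_pos h]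
    exact congrArg _ (he (h.choose_spec.trans hc.symm))
  have hf2 : ∀ a : φ.freeVarFinset, (¬ ∃ c, e c = a) → f a = Sum.inr a := by
    intro a h
    simp only [f, dif_neg h]
  refine ⟨Formula.iExs φ.freeVarFinset (φ.restrictFreeVar f), fun u => ?_⟩
  rw [Formula.realize_iExs]
  constructor
  · rintro ⟨x, hx⟩
    let w : α → M := fun a => if h : ∃ c, e c = a then u h.choose else
      if h' : a ∈ φ.freeVarFinset then x ⟨a, h'⟩ else Classical.arbitrary M
    have hw : ∀ c, w (e c) = u c := by
      intro c
      have h : ∃ c', e c' = e c := ⟨c, rfl⟩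
      simp only [w, dif_pos h]
      exact congrArg u (he h.choose_spec)
    refine ⟨w, funext hw, ?_⟩
    refine (BoundedFormula.realize_restrictFreeVar w fun a => ?_).1 hx
    by_cases h : ∃ c, e c = a
    · obtain ⟨c, hc⟩ := h
      rw [hf1 a c hc, ← hc, hw]
      rfl
    · rw [hf2 a h]
      simp only [w, dif_neg h, Sum.elim_inr, Subtype.coe_eta, Finset.coe_mem, dif_pos]
  · rintro ⟨w, rfl, hw⟩
    refine ⟨fun a => w a, ?_⟩
    refine (BoundedFormula.realize_restrictFreeVar w fun a => ?_).2 hw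
    by_cases h : ∃ c, e c = a
    · obtain ⟨c, hc⟩ := h
      rw [hf1 a c hc, ← hc]
      rfl
    · rw [hf2 a h]
      rfl

lemma realize_congr_of_freeVar {α : Type*} [DecidableEq α] (φ : L.Formula α) {v w : α → M}
    (h : ∀ a ∈ φ.freeVarFinset, v a = w a) : φ.Realize v ↔ φ.Realize w := by
  have h1 := BoundedFormula.realize_restrictFreeVar (φ := φ) (f := fun a => (a : α))
    (v := v) (xs := default) v fun a => rfl
  have h2 := BoundedFormula.realize_restrictFreeVar (φ := φ) (f := fun a => (a : α))
    (v := v) (xs := default) w fun a => h a a.2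
  exact h1.symm.trans h2

/-- In an `ℵ₀`-saturated structure, a finitely satisfiable set of formulas in countably many
variables is realized: the variables are assigned one at a time. -/
lemma IsKSaturated.exists_realize_nat [Nonempty M] {κ : Cardinal.{w}} (hM : IsKSaturated L M κ)
    (hκ : ℵ₀ ≤ κ) {J : Type*} (φ : J → L.Formula ℕ)
    (hfip : ∀ G : Finset J, ∃ v : ℕ → M, ∀ j ∈ G, (φ j).Realize v) :
    ∃ v : ℕ → M, ∀ j, (φ j).Realize v := by
  classical
  -- finite satisfiability with the first `n` variables fixed to the values of `v`
  let Q : ℕ → (ℕ → M) → Prop := fun n v =>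
    ∀ G : Finset J, ∃ w : ℕ → M, (∀ j ∈ G, (φ j).Realize w) ∧ ∀ i < n, w i = v i
  have hstep : ∀ n v, ∃ m, Q n v → Q (n + 1) (Function.update v n m) := by
    intro n v
    by_cases hQ : Q n v
    swap
    · exact ⟨Classical.arbitrary M, fun h => absurd h hQ⟩
    have he : Function.Injective (Sum.elim (fun i : Fin n => (i : ℕ)) fun _ : Fin 1 => n) := by
      rintro (a | a) (b | b) h
      · exact congrArg _ (Fin.ext h)
      · exact absurd h a.2.ne
      · exact absurd h b.2.ne'
      · exact congrArg _ (Subsingleton.elim _ _)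
    choose ψ hψ using fun G : Finset J => exists_formula_proj (M := M)
      (Formula.iInf fun j : G => φ j) he
    simp only [Formula.realize_iInf] at hψ
    have hfin : (Set.range fun i : Fin n => v i).Finite := Set.finite_range _
    obtain ⟨m, hm⟩ := hM.exists_mem_of_fip (A := Set.range fun i : Fin n => v i)
      ((lt_aleph0_iff_set_finite.2 hfin).trans_le hκ) _
      (fun G => definable₁_section (ψ G) (fun i : Fin n => v i) subset_rfl) (by
        intro 𝒢
        obtain ⟨w, hw1, hw2⟩ := hQ (𝒢.biUnion id)
        refine ⟨w n, fun G hG => (hψ _ _).2 ⟨w, ?_, fun j => ?_⟩⟩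
        · ext (i | i)
          · exact hw2 _ i.2
          · rfl
        · exact hw1 _ (Finset.mem_biUnion.2 ⟨G, hG, j.2⟩))
    refine ⟨m, fun _ G => ?_⟩
    obtain ⟨w, hw1, hw2⟩ := (hψ _ _).1 (hm G)
    refine ⟨w, fun j hj => hw2 ⟨j, hj⟩, fun i hi => ?_⟩
    rcases (Nat.lt_succ_iff_lt_or_eq.1 hi) with hi | rfl
    · rw [Function.update_of_ne hi.ne]
      exact congrFun hw1 (Sum.inl ⟨i, hi⟩)
    · rw [Function.update_self]
      exact congrFun hw1 (Sum.inr 0)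
  choose step hstep using hstep
  let seq : ℕ → ℕ → M := fun n =>
    Nat.rec (fun _ => Classical.arbitrary M) (fun n v => Function.update v n (step n v)) n
  have hseq : ∀ n, seq (n + 1) = Function.update (seq n) n (step n (seq n)) := fun n => rfl
  have hQ : ∀ n, Q n (seq n) := by
    intro n
    induction n with
    | zero => exact fun G => (hfip G).imp fun w hw => ⟨hw, fun i hi => absurd hi (Nat.not_lt_zero i)⟩
    | succ n ih => rw [hseq]; exact hstep n _ ih
  have hstab : ∀ i n, i < n → seq n i = seq (i + 1) i := by
    intro i n hin
    induction n, hin using Nat.le_induction with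
    | base => rfl
    | succ n hn ih => rw [hseq, Function.update_of_ne (by omega), ih]
  refine ⟨fun i => seq (i + 1) i, fun j => ?_⟩
  obtain ⟨w, hw1, hw2⟩ := hQ ((φ j).freeVarFinset.sup id + 1) {j}
  refine (realize_congr_of_freeVar (φ j) fun a ha => ?_).1 (hw1 j (Finset.mem_singleton_self j))
  have hlt : a < (φ j).freeVarFinset.sup id + 1 := Nat.lt_succ_of_le (Finset.le_sup (f := id) ha)
  rw [hw2 a hlt, hstab a _ hlt]

lemma IsKSaturated.exists_realize_of_countable [Nonempty M] {κ : Cardinal.{w}}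
    (hM : IsKSaturated L M κ) (hκ : ℵ₀ ≤ κ) {α : Type*} [Countable α] {J : Type*}
    (φ : J → L.Formula α)
    (hfip : ∀ G : Finset J, ∃ v : α → M, ∀ j ∈ G, (φ j).Realize v) :
    ∃ v : α → M, ∀ j, (φ j).Realize v := by
  obtain ⟨e, he⟩ := exists_injective_nat α
  obtain ⟨v, hv⟩ := hM.exists_realize_nat hκ (fun j => (φ j).relabel e) (by
    intro G
    obtain ⟨v, hv⟩ := hfip G
    refine ⟨Function.extend e v fun _ => Classical.arbitrary M, fun j hj => ?_⟩
    have : (Function.extend e v fun _ => Classical.arbitrary M) ∘ e = v :=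
      funext fun a => he.extend_apply _ _ _
    rw [Formula.realize_relabel, this]
    exact hv j hj)
  exact ⟨v ∘ e, fun j => Formula.realize_relabel.1 (hv j)⟩

end Saturation

/-! ### Homogeneity of saturated structures -/

section Homogeneity

open FirstOrder.Language

variable {L : FirstOrder.Language.{u, v}} {M : Type w} [L.Structure M]

variable (L) in
/-- Two families of elements of `M` with the same index set realize the same formulas. -/
def SameType {ι : Type*} (f g : ι → M) : Prop :=
  ∀ φ : L.Formula ι, φ.Realize f ↔ φ.Realize g

lemma SameType.comp {ι κ : Type*} {f g : ι → M} (h : SameType L f g) (r : κ → ι) :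
    SameType L (f ∘ r) (g ∘ r) := fun φ => by
  rw [← Formula.realize_relabel, ← Formula.realize_relabel]
  exact h _

lemma SameType.symm {ι : Type*} {f g : ι → M} (h : SameType L f g) : SameType L g f :=
  fun φ => (h φ).symm

lemma sameType_of_imp {ι : Type*} {f g : ι → M}
    (h : ∀ φ : L.Formula ι, φ.Realize f → φ.Realize g) : SameType L f g := fun φ =>
  ⟨h φ, fun hg => by
    by_contra hf
    exact Formula.realize_not.1 (h φ.not (Formula.realize_not.2 hf)) hg⟩

lemma SameType.eq_iff {ι : Type*} {f g : ι → M} (h : SameType L f g) (i j : ι) :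
    f i = f j ↔ g i = g j := by
  have := h ((Term.var i).equal (Term.var j))
  simpa [Formula.realize_equal] using this

/-- Having the same type is a condition on finite subfamilies. -/
lemma sameType_of_finset {ι : Type*} {f g : ι → M}
    (h : ∀ s : Finset ι, SameType L (fun i : s => f i) fun i : s => g i) : SameType L f g := by
  classical
  intro φ
  have h1 := fun v : ι → M => BoundedFormula.realize_restrictFreeVar (φ := φ)
    (f := fun a => a) (v := fun a => v a) (xs := default) v fun a => rfl
  exact (h1 f).symm.trans ((h φ.freeVarFinset (φ.restrictFreeVar fun a => a)).trans (h1 g))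

/-- The forth step: in a saturated structure a partial elementary map with few values extends to
any further element. -/
lemma SameType.exists_extend (hM : IsSaturated L M) {ι : Type*} {f g : ι → M}
    (h : SameType L f g) (hg : #(Set.range g) < #M) (x : M) :
    ∃ y, SameType L (Sum.elim f fun _ : Fin 1 => x) (Sum.elim g fun _ => y) := by
  classical
  obtain ⟨y, hy⟩ := IsKSaturated.exists_mem_of_fip hM hg
    (fun φ : {φ : L.Formula (ι ⊕ Fin 1) // φ.Realize (Sum.elim f fun _ => x)} =>
      {m | φ.1.Realize (Sum.elim g fun _ => m)})
    (fun φ => definable₁_section φ.1 g subset_rfl) (by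
      intro G
      have h1 : ((Formula.iInf fun φ : G => φ.1.1).iExs (Fin 1)).Realize f := by
        rw [Formula.realize_iExs]
        refine ⟨fun _ => x, ?_⟩
        rw [Formula.realize_iInf]
        exact fun φ => φ.1.2
      rw [h, Formula.realize_iExs] at h1
      obtain ⟨m, hm⟩ := h1
      rw [Formula.realize_iInf] at hm
      refine ⟨m 0, fun φ hφ => ?_⟩
      have := hm ⟨φ, hφ⟩
      have h2 : m = fun _ => m 0 := funext fun i => by rw [Subsingleton.elim i 0]
      rwa [h2] at this)
  exact ⟨y, sameType_of_imp fun φ hφ => hy ⟨φ, hφ⟩⟩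

/-- Dependent choice along a well-founded relation, for a property of functions that at each
stage only concerns the values reached so far. -/
lemma exists_forall_of_wellFounded {α β : Type*} [Nonempty β] {r : α → α → Prop}
    (hr : WellFounded r) (P : α → (α → β) → Prop)
    (hcongr : ∀ m h h', (∀ m', r m' m ∨ m' = m → h m' = h' m') → P m h → P m h')
    (htrans : ∀ a b c, r a b → r b c → r a c)
    (hstep : ∀ m h, (∀ m', r m' m → P m' h) → ∃ b, ∀ h', h' m = b →
      (∀ m', r m' m → h' m' = h m') → P m h') :
    ∃ h : α → β, ∀ m, P m h := by
  classical
  let cut : (m : α) → ((m' : α) → r m' m → β) → α → β := fun m hp m' =>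
    if H : r m' m then hp m' H else Classical.arbitrary β
  let F : (m : α) → ((m' : α) → r m' m → β) → β := fun m hp =>
    Classical.epsilon fun b => ∀ h', h' m = b → (∀ m', r m' m → h' m' = cut m hp m') → P m h'
  let h : α → β := hr.fix F
  have hh : ∀ m, h m = F m fun m' _ => h m' := fun m => hr.fix_eq F m
  refine ⟨h, fun m => ?_⟩
  induction m using hr.induction with
  | _ m ih =>
    have hcut : ∀ m', r m' m → cut m (fun m' _ => h m') m' = h m' := by
      intro m' H
      simp only [cut, dif_pos H]
    have hex := hstep m (cut m fun m' _ => h m') (by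
      intro m' H
      refine hcongr m' h _ ?_ (ih m' H)
      rintro m'' (H' | rfl)
      · exact (hcut m'' (htrans _ _ _ H' H)).symm
      · exact (hcut m'' H).symm)
    have hspec := Classical.epsilon_spec hex
    exact hspec h (hh m) fun m' H => (hcut m' H).symm

/-- In an uncountable saturated structure, a countable partial elementary map extends to an
automorphism. The back-and-forth runs along a well-order of `M` of minimal order type, so that
fewer than `|M|` elements have been treated at each stage. -/
lemma exists_automorphism (hM : IsSaturated L M) (hunc : ℵ₀ < #M) {κ : Type*} [Countable κ]
    {a b : κ → M} (hab : SameType L a b) : ∃ σ : M ≃[L] M, ∀ k, σ (a k) = b k := by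
  classical
  have hinf : Infinite M := infinite_iff.2 hunc.le
  obtain ⟨r, hr, hord⟩ := exists_ord_eq M
  -- `h m` consists of the image and of the preimage chosen for `m`
  let f : (M → M × M) → κ ⊕ M × Bool → M := fun h =>
    Sum.elim a fun p => if p.2 then p.1 else (h p.1).2
  let g : (M → M × M) → κ ⊕ M × Bool → M := fun h =>
    Sum.elim b fun p => if p.2 then (h p.1).1 else p.1
  -- `E T h`: adding to `a ↦ b` the choices of `h` for the elements of `T` gives an elementary map
  let E : Set M → (M → M × M) → Prop := fun T h =>
    SameType L (Sum.elim a fun p : T × Bool => f h (Sum.inr (p.1, p.2)))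
      (Sum.elim b fun p : T × Bool => g h (Sum.inr (p.1, p.2)))
  have hEcongr : ∀ (T : Set M) (h h' : M → M × M), (∀ m ∈ T, h m = h' m) → E T h → E T h' := by
    intro T h h' hT
    have h1 : (fun p : T × Bool => f h (Sum.inr (p.1, p.2))) =
        fun p : T × Bool => f h' (Sum.inr (p.1, p.2)) := by
      ext p
      simp only [f, Sum.elim_inr, hT _ p.1.2]
    have h2 : (fun p : T × Bool => g h (Sum.inr (p.1, p.2))) =
        fun p : T × Bool => g h' (Sum.inr (p.1, p.2)) := by
      ext p
      simp only [g, Sum.elim_inr, hT _ p.1.2]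
    simp only [E, h1, h2, imp_self]
  -- only finite subfamilies matter, and these are bounded by their largest element
  have hEunion : ∀ (T : Set M) (h : M → M × M),
      (∀ m ∈ T, E {m' | r m' m ∨ m' = m} h) → E T h := by
    intro T h hT
    refine sameType_of_finset fun s => ?_
    let t : Finset M := s.biUnion fun i => Sum.elim (fun _ => ∅) (fun p => {(p.1 : M)}) i
    have htT : ∀ m ∈ t, m ∈ T := by
      intro m hm
      obtain ⟨i, -, hi⟩ := Finset.mem_biUnion.1 hm
      rcases i with k | p
      · simp at hi
      · rw [Sum.elim_inr, Finset.mem_singleton] at hi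
        rw [hi]
        exact p.1.2
    rcases t.eq_empty_or_nonempty with h0 | hne
    · have hleft : ∀ i : s, ∃ k, i.1 = Sum.inl k := by
        rintro ⟨k | p, hi⟩
        · exact ⟨k, rfl⟩
        · have : (p.1 : M) ∈ t := Finset.mem_biUnion.2 ⟨_, hi, by simp⟩
          rw [h0] at this
          simp at this
      choose k hk using hleft
      convert hab.comp k using 1 <;> ext i <;> simp [hk i]
    · obtain ⟨m₀, hmax, hle⟩ : ∃ m₀ ∈ t, ∀ m ∈ t, r m m₀ ∨ m = m₀ := by
        let _ : LinearOrder M := linearOrderOfSTO r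
        exact ⟨t.max' hne, t.max'_mem hne, fun m hm => lt_or_eq_of_le (t.le_max' m hm)⟩
      have := hT _ (htT _ hmax)
      have hpos : ∀ i : s, ∃ j : κ ⊕ {m' | r m' m₀ ∨ m' = m₀} × Bool,
          Sum.map id (fun p => ((p.1 : M), p.2)) j
            = Sum.map id (fun p : T × Bool => ((p.1 : M), p.2)) i.1 := by
        rintro ⟨k | p, hi⟩
        · exact ⟨Sum.inl k, rfl⟩
        · exact ⟨Sum.inr (⟨p.1, hle _ (Finset.mem_biUnion.2 ⟨_, hi, by simp⟩)⟩, p.2), rfl⟩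
      choose j hj using hpos
      have hf : ∀ (T' : Set M) (i : κ ⊕ T' × Bool),
          Sum.elim a (fun p : T' × Bool => f h (Sum.inr (p.1, p.2))) i =
            f h (Sum.map id (fun p : T' × Bool => ((p.1 : M), p.2)) i) := by
        rintro T' (k | p) <;> rfl
      have hg : ∀ (T' : Set M) (i : κ ⊕ T' × Bool),
          Sum.elim b (fun p : T' × Bool => g h (Sum.inr (p.1, p.2))) i =
            g h (Sum.map id (fun p : T' × Bool => ((p.1 : M), p.2)) i) := by
        rintro T' (k | p) <;> rfl
      convert this.comp j using 1
      · ext i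
        rw [Function.comp_apply, hf, hf, hj]
      · ext i
        rw [Function.comp_apply, hg, hg, hj]
  have hsmall : ∀ m, #{m' // r m' m} < #M := fun m => card_typein_lt m hord
  have hrange : ∀ (m : M) (F : κ ⊕ {m' | r m' m} × Bool → M), #(Set.range F) < #M := by
    intro m F
    have h1 : Set.range F = Set.range (F ∘ Sum.inl) ∪
        (Set.range (fun p : {m' | r m' m} => F (Sum.inr (p, true))) ∪
          Set.range (fun p : {m' | r m' m} => F (Sum.inr (p, false)))) := by
      ext x
      simp only [Set.mem_range, Sum.exists, Prod.exists, Bool.exists_bool, Set.mem_union,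
        Function.comp_apply]
      constructor
      · rintro (h | ⟨p, h | h⟩)
        · exact Or.inl h
        · exact Or.inr (Or.inr ⟨p, h⟩)
        · exact Or.inr (Or.inl ⟨p, h⟩)
      · rintro (h | ⟨p, h⟩ | ⟨p, h⟩)
        · exact Or.inl h
        · exact Or.inr ⟨p, Or.inr h⟩
        · exact Or.inr ⟨p, Or.inl h⟩
    rw [h1]
    refine (mk_union_le _ _).trans_lt (add_lt_of_lt hunc.le ?_ ((mk_union_le _ _).trans_lt
      (add_lt_of_lt hunc.le ?_ ?_)))
    · exact (mk_le_aleph0_iff.2 (Set.countable_range _).to_subtype).trans_lt hunc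
    · exact mk_range_le.trans_lt (hsmall m)
    · exact mk_range_le.trans_lt (hsmall m)
  obtain ⟨h, hh⟩ := exists_forall_of_wellFounded hr.wf (fun m h => E {m' | r m' m ∨ m' = m} h)
    (fun m h h' H => hEcongr _ _ _ H) (fun _ _ _ => trans_of r) (by
      intro m h H
      have h1 : E {m' | r m' m} h := hEunion _ _ H
      obtain ⟨y, hy⟩ := h1.exists_extend hM (hrange m _) m
      -- the back step is the forth step for the inverse map
      obtain ⟨x, hx⟩ := hy.symm.exists_extend hM (by
        refine lt_of_le_of_lt ?_ (add_lt_of_lt hunc.le (hrange m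
          (Sum.elim a fun p : {m' | r m' m} × Bool => f h (Sum.inr (p.1, p.2))))
          (one_lt_aleph0.trans hunc))
        rw [← mk_singleton m]
        refine le_trans (mk_le_mk_of_subset ?_) (mk_union_le _ _)
        rintro _ ⟨i | i, rfl⟩
        · exact Or.inl ⟨i, rfl⟩
        · exact Or.inr rfl) m
      refine ⟨(y, x), fun h' hm' hlt => ?_⟩
      -- what remains is to identify the index set with two extra points and the one up to `m`
      have hpos : ∀ p : {m' | r m' m ∨ m' = m} × Bool, ∃ j : ({m' | r m' m} × Bool) ⊕ Bool,
          Sum.elim (fun q => ((q.1 : M), q.2)) (fun c => (m, c)) j = ((p.1 : M), p.2) := by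
        rintro ⟨⟨m', h | rfl⟩, c⟩
        · exact ⟨Sum.inl (⟨m', h⟩, c), rfl⟩
        · exact ⟨Sum.inr c, rfl⟩
      choose j hj using hpos
      let ρ : ({m' | r m' m} × Bool) ⊕ Bool → (((κ ⊕ {m' | r m' m} × Bool) ⊕ Fin 1) ⊕ Fin 1) :=
        Sum.elim (fun q => Sum.inl (Sum.inl (Sum.inr q)))
          fun c => if c then Sum.inl (Sum.inr 0) else Sum.inr 0
      have key := hx.symm.comp (Sum.elim (fun k : κ => Sum.inl (Sum.inl (Sum.inl k)))
        fun p : {m' | r m' m ∨ m' = m} × Bool => ρ (j p))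
      have hfgoal : ∀ q : ({m' | r m' m} × Bool) ⊕ Bool, Sum.elim (Sum.elim (Sum.elim a
          fun p : {m' | r m' m} × Bool => f h (Sum.inr (p.1, p.2))) fun _ => m) (fun _ => x) (ρ q) =
          f h' (Sum.inr (Sum.elim (fun q => ((q.1 : M), q.2)) (fun c => (m, c)) q)) := by
        rintro (q | c)
        · simp only [ρ, f, Sum.elim_inl, Sum.elim_inr]
          rw [hlt _ q.1.2]
        · cases c <;> simp [ρ, f, hm']
      have hggoal : ∀ q : ({m' | r m' m} × Bool) ⊕ Bool, Sum.elim (Sum.elim (Sum.elim b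
          fun p : {m' | r m' m} × Bool => g h (Sum.inr (p.1, p.2))) fun _ => y) (fun _ => m) (ρ q) =
          g h' (Sum.inr (Sum.elim (fun q => ((q.1 : M), q.2)) (fun c => (m, c)) q)) := by
        rintro (q | c)
        · simp only [ρ, g, Sum.elim_inl, Sum.elim_inr]
          rw [hlt _ q.1.2]
        · cases c <;> simp [ρ, g, hm']
      convert key using 1
      · ext (k | p)
        · rfl
        · simp only [Sum.elim_inr, Function.comp_apply]
          rw [hfgoal, hj]
      · ext (k | p)
        · rfl
        · simp only [Sum.elim_inr, Function.comp_apply]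
          rw [hggoal, hj])
  have hall : E Set.univ h := hEunion _ _ fun m _ => hh m
  -- reading off the automorphism
  let F : M → M := fun m => (h m).1
  have hF : ∀ {n : ℕ} (φ : L.Formula (Fin n)) (x : Fin n → M),
      φ.Realize (F ∘ x) ↔ φ.Realize x := by
    intro n φ x
    exact ((hall.comp fun i => Sum.inr (⟨x i, trivial⟩, true)) φ).symm
  let e : M ↪ₑ[L] M := ⟨F, fun n φ x => hF φ x⟩
  have hsurj : Function.Surjective F := by
    intro m
    refine ⟨(h m).2, ?_⟩
    have := hall.eq_iff (Sum.inr (⟨(h m).2, trivial⟩, true)) (Sum.inr (⟨m, trivial⟩, false))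
    simpa [f, g] using this
  refine ⟨⟨Equiv.ofBijective F ⟨e.injective, hsurj⟩, fun {n} φ x => e.map_fun φ x,
    fun {n} R x => e.map_rel R x⟩, fun k => ?_⟩
  have := hall.eq_iff (Sum.inr (⟨a k, trivial⟩, true)) (Sum.inl k)
  exact this.1 rfl

end Homogeneity

/-! ### Iterated ultrafilter quantifiers -/

section Iterate

variable (U : Ultrafilter ℕ)

/-- The `n`-fold iterate of an ultrafilter on `ℕ`: a property of `n`-tuples holds eventually iff
`∀ᶠ i₀, ∀ᶠ i₁, …` it holds at `(i₀, i₁, …)`. -/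
def ultraPow : (n : ℕ) → Ultrafilter (Fin n → ℕ)
  | 0 => pure Fin.elim0
  | n + 1 => U.bind fun i => (ultraPow n).map (Fin.cons i)

lemma eventually_ultraPow_succ {n : ℕ} {P : (Fin (n + 1) → ℕ) → Prop} :
    (∀ᶠ v in ultraPow U (n + 1), P v) ↔ ∀ᶠ i in U, ∀ᶠ v in ultraPow U n, P (Fin.cons i v) :=
  Iff.rfl

/-- The iterates of an ultrafilter are compatible with passing to subtuples. -/
lemma eventually_ultraPow_comp {n m : ℕ} {f : Fin m → Fin n} (hf : StrictMono f)
    {P : (Fin m → ℕ) → Prop} :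
    (∀ᶠ v in ultraPow U n, P (v ∘ f)) ↔ ∀ᶠ v in ultraPow U m, P v := by
  induction n generalizing m with
  | zero =>
    obtain rfl : m = 0 := by
      by_contra h
      exact (f ⟨0, Nat.pos_of_ne_zero h⟩).elim0
    have : ∀ v : Fin 0 → ℕ, v ∘ f = v := fun v => Subsingleton.elim _ _
    simp only [this]
  | succ n ih =>
    cases m with
    | zero =>
      have h0 : ∀ v : Fin 0 → ℕ, v = Fin.elim0 := fun v => Subsingleton.elim _ _
      have h1 : ∀ v : Fin (n + 1) → ℕ, v ∘ f = Fin.elim0 := fun v => Subsingleton.elim _ _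
      have h2 : ∀ v : Fin 0 → ℕ, P v ↔ P Fin.elim0 := fun v => by rw [h0 v]
      simp only [h1, h2, eventually_const]
    | succ m =>
      rw [eventually_ultraPow_succ]
      by_cases h0 : f 0 = 0
      · have hpos : ∀ i : Fin m, ∃ j : Fin n, f i.succ = j.succ := fun i =>
          (Fin.exists_succ_eq.2 (((Fin.zero_le _).trans_lt (hf (Fin.succ_pos i))).ne')).imp
            fun _ h => h.symm
        choose g hg using hpos
        have hgm : StrictMono g := fun i j hij => by
          have := hf (Fin.succ_lt_succ_iff.2 hij)
          rwa [hg, hg, Fin.succ_lt_succ_iff] at this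
        have hcons : ∀ i (v : Fin n → ℕ), (Fin.cons i v : Fin (n + 1) → ℕ) ∘ f
            = Fin.cons i (v ∘ g) := by
          intro i v
          ext k
          refine Fin.cases ?_ (fun k => ?_) k
          · simp [h0]
          · simp [hg]
        simp only [hcons]
        rw [eventually_ultraPow_succ]
        exact eventually_congr (Eventually.of_forall fun i => ih (P := fun v => P (Fin.cons i v)) hgm)
      · have hpos : ∀ i : Fin (m + 1), ∃ j : Fin n, f i = j.succ := fun i =>
          (Fin.exists_succ_eq.2 (((Fin.pos_iff_ne_zero.2 h0).trans_le
            (hf.monotone (Fin.zero_le i))).ne')).imp fun _ h => h.symm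
        choose g hg using hpos
        have hgm : StrictMono g := fun i j hij => by
          have := hf hij
          rwa [hg, hg, Fin.succ_lt_succ_iff] at this
        have hcons : ∀ i (v : Fin n → ℕ), (Fin.cons i v : Fin (n + 1) → ℕ) ∘ f = v ∘ g := by
          intro i v
          ext k
          simp [hg]
        simp only [hcons]
        rw [eventually_const]
        exact ih hgm

/-- Iterates of a nonprincipal ultrafilter concentrate on strictly increasing tuples. -/
lemma eventually_ultraPow_strictMono (hU : ∀ k, ∀ᶠ i : ℕ in U, k < i) (n : ℕ) :
    ∀ᶠ v : Fin n → ℕ in ultraPow U n, StrictMono v := by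
  have key : ∀ n k, ∀ᶠ v : Fin n → ℕ in ultraPow U n, StrictMono v ∧ ∀ i, k < v i := by
    intro n
    induction n with
    | zero =>
      exact fun k => Eventually.of_forall fun v => ⟨fun i => i.elim0, fun i => i.elim0⟩
    | succ n ih =>
      intro k
      rw [eventually_ultraPow_succ]
      filter_upwards [hU k] with i hi
      filter_upwards [ih i] with v hv
      refine ⟨?_, fun j => Fin.cases hi (fun j => hi.trans (hv.2 j)) j⟩
      intro a b
      refine Fin.cases (fun h => absurd h (Fin.not_lt_zero a)) (fun b => ?_) b
      refine Fin.cases (fun _ => hv.2 b) (fun a h => ?_) a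
      exact hv.1 (Fin.succ_lt_succ_iff.1 h)
  exact (key n 0).mono fun v h => h.1

lemma exists_ultrafilter_nat : ∃ U : Ultrafilter ℕ, ∀ k, ∀ᶠ i : ℕ in U, k < i := by
  refine ⟨hyperfilter ℕ, fun k => ?_⟩
  have h : ((hyperfilter ℕ : Ultrafilter ℕ) : Filter ℕ) ≤ atTop := by
    rw [← Nat.cofinite_eq_atTop]
    exact hyperfilter_le_cofinite
  exact h (eventually_gt_atTop k)

end Iterate

/-! ### The independence property inside a structure -/

section Independence

open FirstOrder.Language

variable {L : FirstOrder.Language.{u, v}} (M : Type w) [L.Structure M]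

/-- `φ(x; y)` shatters finite sets of every size in `M`. -/
def HasIPIn {ι κ : Type*} (φ : L.Formula (ι ⊕ κ)) : Prop :=
  ∀ n : ℕ, ∃ a : Fin n → ι → M, ∀ J : Set (Fin n), ∃ b : κ → M, ∀ i,
    φ.Realize (Sum.elim (a i) b) ↔ i ∈ J

variable {M}

open Classical in
/-- The formula saying that some `y` satisfies `φ(xᵢ, y)` exactly for the `i` in `J`. -/
noncomputable def patternFormula {ι κ ξ : Type*} [Finite κ] [Finite ξ] (φ : L.Formula (ι ⊕ κ))
    (J : Set ξ) : L.Formula (ξ × ι) :=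
  Formula.iExs κ (Formula.iInf fun i : ξ =>
    if i ∈ J then φ.relabel (Sum.map (Prod.mk i) id) else (φ.relabel (Sum.map (Prod.mk i) id)).not)

lemma realize_patternFormula {ι κ ξ : Type*} [Finite κ] [Finite ξ] (φ : L.Formula (ι ⊕ κ))
    (J : Set ξ) (u : ξ × ι → M) : (patternFormula φ J).Realize u ↔
      ∃ b : κ → M, ∀ i, φ.Realize (Sum.elim (fun x => u (i, x)) b) ↔ i ∈ J := by
  rw [patternFormula, Formula.realize_iExs]
  refine exists_congr fun b => ?_
  rw [Formula.realize_iInf]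
  refine forall_congr' fun i => ?_
  have h : (φ.relabel (Sum.map (Prod.mk i) id)).Realize (Sum.elim u b) ↔
      φ.Realize (Sum.elim (fun x => u (i, x)) b) := by
    rw [Formula.realize_relabel]
    refine iff_of_eq (congrArg _ ?_)
    ext (x | y) <;> rfl
  split_ifs with hi
  · rw [h]; simp [hi]
  · rw [Formula.realize_not, h]; simp [hi]

/-- The independence property of a formula is expressed by a set of sentences. -/
lemma hasIPIn_iff {ι κ : Type*} [Finite ι] [Finite κ] (φ : L.Formula (ι ⊕ κ)) :
    HasIPIn M φ ↔ ∀ n : ℕ, M ⊨ (Formula.iExs (Fin n × ι) ((Formula.iInf fun J : Set (Fin n) =>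
      patternFormula φ J).relabel Sum.inr) : L.Sentence) := by
  refine forall_congr' fun n => ?_
  rw [Sentence.Realize, Formula.realize_iExs]
  simp only [Formula.realize_relabel, Formula.realize_iInf, realize_patternFormula]
  constructor
  · rintro ⟨a, ha⟩
    exact ⟨fun p => a p.1 p.2, ha⟩
  · rintro ⟨u, hu⟩
    exact ⟨fun i x => u (i, x), hu⟩

lemma HasIPIn.transfer {T : L.Theory} (hT : T.IsComplete) {N : Type*} [L.Structure N]
    [M ⊨ T] [Nonempty M] [N ⊨ T] [Nonempty N] {ι κ : Type*} [Finite ι] [Finite κ]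
    {φ : L.Formula (ι ⊕ κ)} (h : HasIPIn M φ) : HasIPIn N φ := by
  rw [hasIPIn_iff] at *
  exact fun n => (hT.realize_sentence_iff _ N).2 ((hT.realize_sentence_iff _ M).1 (h n))

/-- The independence property is symmetric in the two groups of variables. -/
lemma HasIPIn.dual {ι κ : Type*} {φ : L.Formula (ι ⊕ κ)} (h : HasIPIn M φ) :
    HasIPIn M (φ.relabel (Sum.swap : ι ⊕ κ → κ ⊕ ι)) := by
  intro n
  obtain ⟨a, ha⟩ := h (Nat.card (Set (Fin n)))
  -- points indexed by the subsets of `Fin n` are split by the sets `{J | i ∈ J}`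
  choose b hb using fun i : Fin n => ha {j | i ∈ (Finite.equivFin (Set (Fin n))).symm j}
  refine ⟨b, fun J => ⟨a (Finite.equivFin _ J), fun i => ?_⟩⟩
  rw [Formula.realize_relabel, Sum.elim_swap]
  simpa using hb i (Finite.equivFin _ J)

lemma HasIPIn.relabel {ι ι' κ κ' : Type*} {φ : L.Formula (ι ⊕ κ)} (h : HasIPIn M φ)
    (e : ι ≃ ι') (e' : κ ≃ κ') : HasIPIn M (φ.relabel (Sum.map e e')) := by
  intro n
  obtain ⟨a, ha⟩ := h n
  refine ⟨fun i => a i ∘ e.symm, fun J => ?_⟩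
  obtain ⟨b, hb⟩ := ha J
  refine ⟨b ∘ e'.symm, fun i => ?_⟩
  rw [← hb i, Formula.realize_relabel, Sum.elim_comp_map]
  simp [Function.comp_assoc]

lemma HasIPIn.infinite {ι κ : Type*} [Finite κ] {φ : L.Formula (ι ⊕ κ)} (h : HasIPIn M φ) :
    Infinite M := by
  by_contra hfin
  rw [not_infinite_iff_finite] at hfin
  obtain ⟨n, hn⟩ : ∃ n, Nat.card (κ → M) < Nat.card (Set (Fin n)) := by
    refine ⟨Nat.card (κ → M), ?_⟩
    rw [Nat.card_eq_fintype_card (α := Set _), Fintype.card_set, Fintype.card_fin]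
    exact Nat.lt_two_pow_self
  obtain ⟨a, ha⟩ := h n
  choose b hb using ha
  have hinj : Function.Injective b := by
    intro J J' hJ
    ext i
    rw [← hb, ← hb, hJ]
  exact absurd (Nat.card_le_card_of_injective b hinj) (not_le.2 hn)

/-! ### Indiscernible sequences -/

variable (L) in
/-- A sequence of `ι`-tuples is indiscernible if any two increasing finite subsequences of the same
length realize the same formulas. -/
def IsIndiscernible {ι : Type*} (a : ℤ → ι → M) : Prop :=
  ∀ (n : ℕ) (f g : Fin n → ℤ), StrictMono f → StrictMono g →
    SameType L (fun p : Fin n × ι => a (f p.1) p.2) fun p => a (g p.1) p.2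

/-- Compactness turns arbitrarily large shattered sets into an infinite sequence all of whose
finite parts are shattered. -/
lemma HasIPIn.exists_seq [Nonempty M] {c : Cardinal.{w}} (hM : IsKSaturated L M c) (hc : ℵ₀ ≤ c)
    {ι κ : Type*} [Finite ι] [Finite κ] {φ : L.Formula (ι ⊕ κ)} (h : HasIPIn M φ) :
    ∃ e : ℕ → ι → M, ∀ (n : ℕ) (J : Set ℕ), ∃ b : κ → M, ∀ i < n,
      φ.Realize (Sum.elim (e i) b) ↔ i ∈ J := by
  classical
  obtain ⟨u, hu⟩ := hM.exists_realize_of_countable hc (α := ℕ × ι)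
    (fun p : Σ n : ℕ, Set (Fin n) => (patternFormula φ p.2).relabel
      (Prod.map (fun i : Fin p.1 => (i : ℕ)) id)) (by
      intro G
      obtain ⟨a, ha⟩ := h (G.sup fun p => p.1)
      refine ⟨fun q => if hq : q.1 < G.sup fun p => p.1 then a ⟨q.1, hq⟩ q.2 else
        Classical.arbitrary M, fun p hp => ?_⟩
      have hle : p.1 ≤ G.sup fun p => p.1 := Finset.le_sup (f := fun p => p.1) hp
      rw [Formula.realize_relabel, realize_patternFormula]
      obtain ⟨b, hb⟩ := ha (Fin.castLE hle '' p.2)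
      refine ⟨b, fun i => ?_⟩
      have h1 := hb (Fin.castLE hle i)
      rw [(Fin.castLE_injective hle).mem_set_image] at h1
      rw [← h1]
      refine iff_of_eq (congrArg (fun w => φ.Realize (Sum.elim w b)) ?_)
      ext x
      simp only [Function.comp_apply, Prod.map_apply, id, dif_pos (i.2.trans_le hle)]
      rfl)
  refine ⟨fun i x => u (i, x), fun n J => ?_⟩
  have := hu ⟨n, {i | (i : ℕ) ∈ J}⟩
  rw [Formula.realize_relabel, realize_patternFormula] at this
  obtain ⟨b, hb⟩ := this
  exact ⟨b, fun i hi => hb ⟨i, hi⟩⟩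

/-- In a saturated structure, a formula with the independence property cuts out any prescribed
subset of some indiscernible sequence indexed by `ℤ`. The type of the sequence is the one given by
iterated ultrafilter quantifiers along a shattered sequence, which makes Ramsey's theorem
unnecessary. -/
lemma HasIPIn.exists_indiscernible [Nonempty M] {c : Cardinal.{w}} (hM : IsKSaturated L M c)
    (hc : ℵ₀ ≤ c) {ι κ : Type*} [Finite ι] [Finite κ] {φ : L.Formula (ι ⊕ κ)}
    (h : HasIPIn M φ) (J : Set ℤ) :
    ∃ (a : ℤ → ι → M) (b : κ → M), IsIndiscernible L a ∧
      ∀ j, φ.Realize (Sum.elim (a j) b) ↔ j ∈ J := by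
  classical
  obtain ⟨e, he⟩ := h.exists_seq hM hc
  obtain ⟨U, hU⟩ := exists_ultrafilter_nat
  let A := Σ n : ℕ, {θ : L.Formula (Fin n × ι) // ∀ᶠ v : Fin n → ℕ in ultraPow U n,
    θ.Realize fun p => e (v p.1) p.2} × {f : Fin n → ℤ // StrictMono f}
  let F : A ⊕ ℤ → L.Formula ((ℤ × ι) ⊕ κ) := Sum.elim
    (fun p => p.2.1.1.relabel fun q => Sum.inl (p.2.2.1 q.1, q.2))
    (fun j => if j ∈ J then φ.relabel (Sum.map (Prod.mk j) id)
      else (φ.relabel (Sum.map (Prod.mk j) id)).not)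
  have hFj : ∀ (j : ℤ) (w : (ℤ × ι) ⊕ κ → M), (F (Sum.inr j)).Realize w ↔
      (φ.Realize (Sum.elim (fun x => w (Sum.inl (j, x))) (w ∘ Sum.inr)) ↔ j ∈ J) := by
    intro j w
    have h1 : (φ.relabel (Sum.map (Prod.mk j) id)).Realize w ↔
        φ.Realize (Sum.elim (fun x => w (Sum.inl (j, x))) (w ∘ Sum.inr)) := by
      rw [Formula.realize_relabel]
      refine iff_of_eq (congrArg _ ?_)
      ext (x | y) <;> rfl
    by_cases hj : j ∈ J
    · simp only [F, Sum.elim_inr, if_pos hj]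
      simp only [h1, hj, iff_true]
    · simp only [F, Sum.elim_inr, if_neg hj]
      simp only [Formula.realize_not, h1, hj, iff_false]
  obtain ⟨w, hw⟩ := hM.exists_realize_of_countable hc F (by
    intro G
    -- the finite set of positions in `ℤ` that occur in `G`
    let W : Finset ℤ := G.biUnion fun k =>
      Sum.elim (fun p : A => Finset.univ.image p.2.2.1) (fun j => {j}) k
    have hWf : ∀ p : A, Sum.inl p ∈ G → ∀ i, p.2.2.1 i ∈ W := fun p hp i =>
      Finset.mem_biUnion.2 ⟨_, hp, Finset.mem_image_of_mem _ (Finset.mem_univ i)⟩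
    have hWj : ∀ j, (Sum.inr j : A ⊕ ℤ) ∈ G → j ∈ W := fun j hj =>
      Finset.mem_biUnion.2 ⟨_, hj, Finset.mem_singleton_self j⟩
    let o : Fin W.card ≃o W := W.orderIsoOfFin rfl
    have hev : ∀ᶠ v in ultraPow U W.card, StrictMono v ∧ ∀ k ∈ G, ∀ p : A, ∀ hk : k = Sum.inl p,
        ∀ hp : Sum.inl p ∈ G, p.2.1.1.Realize
          fun q => e (v (o.symm ⟨p.2.2.1 q.1, hWf p hp q.1⟩)) q.2 := by
      refine (eventually_ultraPow_strictMono U hU _).and ?_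
      rw [Filter.eventually_all_finset]
      rintro (p | j) hk
      · have hmono : StrictMono fun i => o.symm ⟨p.2.2.1 i, hWf p hk i⟩ := fun i j hij =>
          o.symm.strictMono (p.2.2.2 hij)
        filter_upwards [(eventually_ultraPow_comp U hmono).2 p.2.1.2] with v hv p' hp' _
        cases hp'
        exact hv
      · exact Eventually.of_forall fun v p hp => absurd hp (by simp)
    obtain ⟨v, hv, hvG⟩ := hev.exists
    obtain ⟨b, hb⟩ := he (Finset.univ.sup v + 1) {i | ∃ k, v k = i ∧ ((o k : W) : ℤ) ∈ J}
    let x : ℤ → ι → M := fun j => if hj : j ∈ W then e (v (o.symm ⟨j, hj⟩)) else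
      fun _ => Classical.arbitrary M
    have hx : ∀ j (hj : j ∈ W), x j = e (v (o.symm ⟨j, hj⟩)) := fun j hj => dif_pos hj
    refine ⟨Sum.elim (fun q => x q.1 q.2) b, ?_⟩
    rintro (p | j) hk
    · have := hvG _ hk p rfl hk
      simp only [F, Sum.elim_inl, Formula.realize_relabel]
      refine (iff_of_eq (congrArg _ ?_)).1 this
      ext q
      simp [hx _ (hWf p hk q.1)]
    · rw [hFj]
      have h1 := hb (v (o.symm ⟨j, hWj j hk⟩))
        (Nat.lt_succ_of_le (Finset.le_sup (f := v) (Finset.mem_univ _)))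
      rw [← hx j (hWj j hk)] at h1
      refine h1.trans ?_
      constructor
      · rintro ⟨k, hk1, hk2⟩
        rw [hv.injective hk1] at hk2
        simpa using hk2
      · exact fun hj => ⟨_, rfl, by simpa using hj⟩)
  refine ⟨fun j x => w (Sum.inl (j, x)), w ∘ Sum.inr, fun n f g hf hg θ => ?_, fun j =>
    (hFj j w).1 (hw (Sum.inr j))⟩
  have key : ∀ θ : L.Formula (Fin n × ι), (∀ᶠ v : Fin n → ℕ in ultraPow U n,
      θ.Realize fun p => e (v p.1) p.2) → ∀ f : Fin n → ℤ, StrictMono f →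
        θ.Realize fun p => w (Sum.inl (f p.1, p.2)) := fun θ hθ f hf => by
    have h1 := hw (Sum.inl ⟨n, ⟨θ, hθ⟩, ⟨f, hf⟩⟩)
    simp only [F, Sum.elim_inl, Formula.realize_relabel] at h1
    exact h1
  by_cases hθ : ∀ᶠ v : Fin n → ℕ in ultraPow U n, θ.Realize fun p => e (v p.1) p.2
  · exact iff_of_true (key θ hθ f hf) (key θ hθ g hg)
  · have hθ' : ∀ᶠ v : Fin n → ℕ in ultraPow U n, θ.not.Realize fun p => e (v p.1) p.2 :=
      Ultrafilter.eventually_not.2 hθ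
    exact iff_of_false (key θ.not hθ' f hf) (key θ.not hθ' g hg)

/-- An indiscernible sequence has the same type as its translate. -/
lemma IsIndiscernible.sameType_add_one {a : ℤ → Fin 1 → M} (ha : IsIndiscernible L a) :
    SameType L (fun k => a k 0) fun k => a (k + 1) 0 := by
  refine sameType_of_finset fun W => ?_
  let o : Fin W.card ≃o W := W.orderIsoOfFin rfl
  have := ha W.card (fun i => (o i : ℤ)) (fun i => (o i : ℤ) + 1)
    (fun i j h => o.strictMono h) (fun i j h => by
      have : (o i : ℤ) < o j := o.strictMono h
      simpa using this)
  have h2 := this.comp fun k : W => (o.symm k, (0 : Fin 1))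
  simpa [Function.comp_def] using h2

/-! ### Reduction to a single variable -/

/-- If a formula `φ(x; y₁, y')` has the independence property, then so does a formula with the
single parameter variable `y₁`, or a formula in which `y₁` is moved to the variables `x`. Take
an indiscernible sequence `a` and `b` with `φ(aⱼ, b)` iff `j` is even. If the type over `b₁` of
`(a_{2i+ε})` does not depend on the choice of the `ε`'s, all patterns of `φ(x, b₁; y')` are realized
on the `a_{2i}`. Otherwise a formula over `b₁` tells two choices apart, and its alternation
along the indiscernible sequence `a` yields the independence property. -/
lemma HasIPIn.step [Nonempty M] {c : Cardinal.{w}} (hM : IsKSaturated L M c) (hc : ℵ₀ ≤ c)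
    {ι : Type} [Finite ι] {t : ℕ} {φ : L.Formula (ι ⊕ Fin (t + 1))} (h : HasIPIn M φ) :
    (∃ (n : ℕ) (δ : L.Formula ((Fin n × ι) ⊕ Fin 1)), HasIPIn M δ) ∨
      ∃ ψ : L.Formula ((ι ⊕ Fin 1) ⊕ Fin t), HasIPIn M ψ := by
  classical
  obtain ⟨a, b, ha, hab⟩ := h.exists_indiscernible hM hc {j | Even j}
  obtain ⟨U, hU⟩ := exists_ultrafilter_nat
  -- an even position for the indices in `S`, an odd one for the others
  let pos : {n : ℕ} → Set (Fin n) → (Fin n → ℕ) → Fin n → ℤ := fun S v i =>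
    2 * (v i : ℤ) + if i ∈ S then 0 else 1
  have hpos : ∀ {n : ℕ} (S : Set (Fin n)) (v : Fin n → ℕ) (i : Fin n),
      Even (pos S v i) ↔ i ∈ S := by
    intro n S v i
    simp only [pos]
    split_ifs with hi
    · simp [hi]
    · simp only [hi, iff_false, Int.not_even_iff_odd]
      exact ⟨_, rfl⟩
  let C : (n : ℕ) → L.Formula ((Fin n × ι) ⊕ Fin 1) → Set (Fin n) → (Fin n → ℕ) → Prop :=
    fun n δ S v => δ.Realize (Sum.elim (fun p => a (pos S v p.1) p.2) fun _ => b 0)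
  by_cases hcase : ∀ n δ S S', (∀ᶠ v in ultraPow U n, C n δ S v) → ∀ᶠ v in ultraPow U n, C n δ S' v
  · right
    let ρ : ι ⊕ Fin (t + 1) → (ι ⊕ Fin 1) ⊕ Fin t :=
      Sum.elim (fun x => Sum.inl (Sum.inl x)) (Fin.cases (Sum.inl (Sum.inr 0)) Sum.inr)
    have hρ : ∀ (x : ι → M) (y : Fin 1 → M) (y' : Fin t → M),
        Sum.elim (Sum.elim x y) y' ∘ ρ = Sum.elim x (Fin.cons (y 0) y') := by
      intro x y y'
      ext (i | k)
      · rfl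
      · refine Fin.cases rfl (fun k => rfl) k
    refine ⟨φ.relabel ρ, fun n => ?_⟩
    let δ : Set (Fin n) → L.Formula ((Fin n × ι) ⊕ Fin 1) := fun S =>
      (patternFormula (φ.relabel ρ) S).relabel fun q =>
        Sum.elim (fun x => Sum.inl (q.1, x)) Sum.inr q.2
    have hδ : ∀ (S : Set (Fin n)) (x : Fin n × ι → M) (y : Fin 1 → M),
        (δ S).Realize (Sum.elim x y) ↔ ∃ y' : Fin t → M, ∀ i,
          (φ.relabel ρ).Realize (Sum.elim (Sum.elim (fun k => x (i, k)) y) y') ↔ i ∈ S := by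
      intro S x y
      rw [Formula.realize_relabel, realize_patternFormula]
      refine exists_congr fun y' => forall_congr' fun i => ?_
      have : (fun k => (Sum.elim x y ∘ fun q : Fin n × (ι ⊕ Fin 1) =>
          Sum.elim (fun x => Sum.inl (q.1, x)) Sum.inr q.2) (i, k)) =
          Sum.elim (fun k => x (i, k)) y := by
        ext (k | k) <;> rfl
      rw [this]
    -- the tail of `b` witnesses the pattern `S` when the positions have the parities given by `S`
    have hSS : ∀ S : Set (Fin n), ∀ᶠ v in ultraPow U n, C n (δ S) S v := by
      intro S
      refine Eventually.of_forall fun v => (hδ _ _ _).2 ⟨Fin.tail b, fun i => ?_⟩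
      rw [Formula.realize_relabel, hρ, Fin.cons_self_tail]
      exact (hab _).trans (hpos S v i)
    obtain ⟨v, hv⟩ := (Filter.eventually_all.2 fun S =>
      hcase n (δ S) S Set.univ (hSS S)).exists
    exact ⟨fun i => Sum.elim (a (pos Set.univ v i)) fun _ => b 0, fun S => (hδ _ _ _).1 (hv S)⟩
  · left
    push Not at hcase
    obtain ⟨n, δ, S, S', hS, hS'⟩ := hcase
    have hS'' : ∀ᶠ v in ultraPow U n, ¬ C n δ S' v := hS'
    refine ⟨n, δ, fun m => ⟨fun l p => a ((finProdFinEquiv (l, p.1) : Fin (m * n)) : ℕ) p.2,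
      fun R => ?_⟩⟩
    -- the `l`-th of the `m` consecutive blocks of `n` indices
    have hblock : ∀ l : Fin m, StrictMono fun i : Fin n => finProdFinEquiv (l, i) := by
      intro l i j hij
      rw [Fin.lt_def]
      simpa [finProdFinEquiv] using hij
    have hev : ∀ᶠ w in ultraPow U (m * n), StrictMono w ∧ ∀ l : Fin m,
        (C n δ (if l ∈ R then S else S') (w ∘ fun i => finProdFinEquiv (l, i)) ↔ l ∈ R) := by
      refine (eventually_ultraPow_strictMono U hU _).and (Filter.eventually_all.2 fun l => ?_)
      by_cases hl : l ∈ R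
      · simp only [hl, if_true, iff_true]
        exact (eventually_ultraPow_comp U (hblock l)).2 hS
      · simp only [hl, if_false, iff_false]
        exact (eventually_ultraPow_comp U (hblock l)).2 hS''
    obtain ⟨w, hw, hwR⟩ := hev.exists
    -- in the blocks `l ∈ R` the parities are taken from `S`, in the others from `S'`
    let T : Set (Fin (m * n)) :=
      {q | (finProdFinEquiv.symm q).2 ∈ if (finProdFinEquiv.symm q).1 ∈ R then S else S'}
    have hmono : StrictMono (pos T w) := by
      intro i j hij
      have : (w i : ℤ) < w j := by exact_mod_cast hw hij
      simp only [pos]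
      split_ifs <;> omega
    have hmono' : StrictMono fun q : Fin (m * n) => ((q : ℕ) : ℤ) := fun i j hij =>
      Int.ofNat_lt.2 hij
    have hT : ∀ l i, finProdFinEquiv (l, i) ∈ T ↔ i ∈ if l ∈ R then S else S' := fun l i => by
      simp only [T, Set.mem_ofPred_eq, Equiv.symm_apply_apply]
    have hsame := (ha (m * n) _ _ hmono hmono').comp
      fun q : Fin m × (Fin n × ι) => (finProdFinEquiv (q.1, q.2.1), q.2.2)
    have h1 := hsame (patternFormula δ R)
    rw [realize_patternFormula, realize_patternFormula] at h1
    refine h1.1 ⟨fun _ => b 0, fun l => ?_⟩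
    rw [← hwR l]
    refine iff_of_eq (congrArg (fun x => δ.Realize (Sum.elim x fun _ => b 0)) ?_)
    ext p
    simp only [pos, hT, Function.comp_apply]

/-- If some formula has the independence property in a saturated structure, then so does some
formula `φ(x; y)` with `x` a single variable. -/
lemma HasIPIn.exists_singleton [Nonempty M] {c : Cardinal.{w}} (hM : IsKSaturated L M c)
    (hc : ℵ₀ ≤ c) {k t : ℕ} {φ : L.Formula (Fin k ⊕ Fin t)} (h : HasIPIn M φ) :
    ∃ (s : ℕ) (ψ : L.Formula (Fin 1 ⊕ Fin s)), HasIPIn M ψ := by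
  have key : ∀ (t : ℕ) (ι : Type) [Finite ι] (φ : L.Formula (ι ⊕ Fin t)), HasIPIn M φ →
      ∃ (ι' : Type) (_ : Finite ι') (δ : L.Formula (ι' ⊕ Fin 1)), HasIPIn M δ := by
    intro t
    induction t with
    | zero =>
      intro ι _ φ h
      obtain ⟨a, ha⟩ := h 1
      obtain ⟨b, hb⟩ := ha ∅
      obtain ⟨b', hb'⟩ := ha Set.univ
      rw [Subsingleton.elim b' b] at hb'
      exact absurd ((hb' 0).2 trivial) (fun h => (hb 0).1 h)
    | succ t ih =>
      intro ι _ φ h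
      rcases h.step hM hc with ⟨n, δ, hδ⟩ | ⟨ψ, hψ⟩
      · exact ⟨_, inferInstance, δ, hδ⟩
      · exact ih _ ψ hψ
  obtain ⟨ι', _, δ, hδ⟩ := key t _ φ h
  exact ⟨_, _, hδ.dual.relabel (Equiv.refl _) (Finite.equivFin ι')⟩

end Independence

/-! ### Automorphisms and definable sets -/

section Automorphisms

open FirstOrder.Language

variable {L : FirstOrder.Language.{u, v}} {M : Type w} [L.Structure M]

lemma mem_inst {t : ℕ} {φ : L.Formula (Fin 1 ⊕ Fin t)} {c : Fin t → M} {m : M} :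
    m ∈ inst M φ c ↔ φ.Realize (Sum.elim (fun _ => m) c) := Iff.rfl

lemma apply_mem_inst {N : Type*} [L.Structure N] (σ : M ≃[L] N) {t : ℕ}
    (φ : L.Formula (Fin 1 ⊕ Fin t)) (c : Fin t → M) (m : M) :
    σ m ∈ inst N φ (σ ∘ c) ↔ m ∈ inst M φ c := by
  rw [mem_inst, mem_inst, ← StrongHomClass.realize_formula σ φ]
  refine iff_of_eq (congrArg _ ?_)
  ext (i | i) <;> rfl

lemma zpow_mem_inst (σ : M ≃[L] M) {t : ℕ} (φ : L.Formula (Fin 1 ⊕ Fin t)) (i : ℤ)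
    (c : Fin t → M) (m : M) :
    (σ.toEquiv ^ i : Equiv.Perm M) m ∈ inst M φ ((σ.toEquiv ^ i : Equiv.Perm M) ∘ c) ↔
      m ∈ inst M φ c := by
  let s : Equiv.Perm M := σ.toEquiv
  have h1 : ∀ (c : Fin t → M) (m : M), s m ∈ inst M φ (s ∘ c) ↔ m ∈ inst M φ c :=
    apply_mem_inst σ φ
  change (s ^ i) m ∈ inst M φ ((s ^ i : Equiv.Perm M) ∘ c) ↔ m ∈ inst M φ c
  induction i generalizing c m with
  | zero => rfl
  | succ i ih =>
    have h2 : s ^ ((i : ℤ) + 1) = s * s ^ (i : ℤ) := by rw [add_comm, zpow_one_add]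
    rw [h2]
    exact (h1 _ _).trans (ih c m)
  | pred i ih =>
    have h2 : s ^ (-(i : ℤ)) = s * s ^ (-(i : ℤ) - 1) := by rw [← zpow_one_add, add_sub_cancel]
    rw [← ih c m, h2]
    exact (h1 _ _).symm

lemma definable₁_inst {t : ℕ} (φ : L.Formula (Fin 1 ⊕ Fin t)) (c : Fin t → M) :
    (Set.univ : Set M).Definable₁ L (inst M φ c) := by
  convert definable₁_section (φ.relabel Sum.swap) c (Set.subset_univ _) using 1
  ext m
  rw [mem_inst, Set.mem_ofPred_eq, Formula.realize_relabel, Sum.elim_swap]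

/-- Every definable set is an instance of a formula without parameters. -/
lemma exists_eq_inst {A : Set M} {s : Set M} (h : A.Definable₁ L s) :
    ∃ (t : ℕ) (φ : L.Formula (Fin 1 ⊕ Fin t)) (c : Fin t → M), s = inst M φ c := by
  obtain ⟨A₀, -, h₀⟩ := Set.definable_iff_finitely_definable.1 h
  obtain ⟨ψ, hψ⟩ := Set.definable_iff_exists_formula_sum.1 h₀
  let e := Finite.equivFin (A₀ : Set M)
  refine ⟨_, ψ.relabel (Sum.elim (fun x => Sum.inr (e x)) Sum.inl), fun i => (e.symm i : M), ?_⟩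
  ext m
  have h1 := congrArg (fun S : Set (Fin 1 → M) => (fun _ => m) ∈ S) hψ
  simp only [Set.mem_ofPred_eq, eq_iff_iff] at h1
  rw [h1, mem_inst, Formula.realize_relabel]
  refine iff_of_eq (congrArg _ ?_)
  ext (x | i)
  · simp
  · rfl

lemma isSetRing_definable₁ (A : Set M) : IsSetRing {s : Set M | A.Definable₁ L s} where
  empty_mem := Set.definable_empty
  union_mem _ _ hs ht := Set.Definable.union hs ht
  sdiff_mem _ _ hs ht := Set.Definable.sdiff hs ht

lemma definable₁_univ (A : Set M) : A.Definable₁ L (Set.univ : Set M) := Set.definable_univ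

lemma definable₁_preimage (σ : M ≃[L] M) {s : Set M} (h : (Set.univ : Set M).Definable₁ L s) :
    (Set.univ : Set M).Definable₁ L (σ ⁻¹' s) := by
  obtain ⟨t, φ, c, rfl⟩ := exists_eq_inst h
  convert definable₁_inst φ (σ.symm ∘ c) using 1
  ext m
  rw [Set.mem_preimage, ← apply_mem_inst σ φ (σ.symm ∘ c) m]
  have : σ ∘ σ.symm ∘ c = c := by
    ext i
    simp
  rw [this]

/-! ### Wide formulas -/

/-- An element whose return set is wide has an infinite orbit: return sets of periodic elements are
periodic. -/
lemma IsWide.injective_zpow {X : Type*} {σ : Equiv.Perm X} {B : Set X} {a : X} {ε : ℝ}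
    (hε : 0 < ε) (h : IsWide ε (returnSet σ B a)) : Function.Injective fun i : ℤ => (σ ^ i) a := by
  intro i j hij
  by_contra hne
  obtain ⟨d, hd, H⟩ := h
  obtain ⟨d', hd', hle⟩ := H (i - j) (sub_ne_zero.2 hne)
  have hper : returnSet σ B a ∩ shift (i - j) (returnSet σ B a) = returnSet σ B a := by
    rw [Set.inter_eq_left]
    intro x hx
    rw [mem_shift]
    change (σ ^ (x - (i - j))) a ∈ B
    have h1 : x - (i - j) = (x - i) + j := by ring
    have h2 : x = (x - i) + i := by ring
    change (σ ^ x) a ∈ B at hx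
    rw [h2, zpow_add, Equiv.Perm.mul_apply] at hx
    rw [h1, zpow_add, Equiv.Perm.mul_apply, ← show (σ ^ i) a = (σ ^ j) a from hij]
    exact hx
  rw [hper] at hd'
  have := tendsto_nhds_unique hd hd'
  linarith

lemma StrongWideIn.weakWideIn {t : ℕ} {φ : L.Formula (Fin 1 ⊕ Fin t)} (h : StrongWideIn M φ) :
    WeakWideIn M φ := by
  obtain ⟨a, c, σ, ε, hε, hw⟩ := h
  let s : Equiv.Perm M := σ.toEquiv
  have h0 : ∀ i : ℤ, (s ^ i) a ∈ tracePart M φ (fun i => (s ^ i) a)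
      (fun n => (s ^ n : Equiv.Perm M) ∘ c) 0 ↔ (s ^ i) a ∈ inst M φ c := by
    intro i
    constructor
    · rintro ⟨j, hj, hj'⟩
      rw [← hj]
      simpa using hj'
    · exact fun hi => ⟨i, rfl, by simpa using hi⟩
  refine ⟨fun i => (s ^ i) a, fun n => (s ^ n : Equiv.Perm M) ∘ c, ε, hw.injective_zpow hε, hε,
    fun n => ?_, ?_⟩
  · ext m
    simp only [Set.mem_ofPred_eq, h0]
    constructor
    · rintro ⟨i, rfl, hi⟩
      refine ⟨i - n, ?_, by rw [sub_add_cancel]⟩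
      rw [← zpow_mem_inst σ φ n, ← Equiv.Perm.mul_apply]
      change (s ^ n * s ^ (i - n)) a ∈ _
      rwa [← zpow_add, add_sub_cancel]
    · rintro ⟨i, hi, rfl⟩
      refine ⟨i + n, rfl, ?_⟩
      rw [← zpow_mem_inst σ φ n, ← Equiv.Perm.mul_apply] at hi
      change (s ^ n * s ^ i) a ∈ _ at hi
      rwa [← zpow_add, add_comm] at hi
  · simp only [h0]
    exact hw

/-- The translates of a wide trace are again traces, and they shatter finite sets. -/
lemma WeakWideIn.hasIPIn {t : ℕ} {φ : L.Formula (Fin 1 ⊕ Fin t)} (h : WeakWideIn M φ) :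
    HasIPIn M φ := by
  obtain ⟨a, c, ε, ha, hε, htr, hw⟩ := h
  intro n
  obtain ⟨x, hx⟩ := hw.exists_shattered hε n
  refine ⟨fun l _ => a (x l), fun J => ?_⟩
  obtain ⟨i, hi⟩ := hx J
  refine ⟨c i, fun l => ?_⟩
  rw [← hi l]
  have h1 : a (x l) ∈ tracePart M φ a c i ↔ a (x l) ∈ inst M φ (c i) := by
    constructor
    · rintro ⟨j, hj, hj'⟩
      rwa [← hj]
    · exact fun hm => ⟨_, rfl, hm⟩
  rw [htr] at h1
  refine h1.symm.trans ?_
  constructor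
  · rintro ⟨j, hj, hj'⟩
    have : x l - i = j := by rw [ha hj']; ring
    rw [this]
    exact hj
  · exact fun hm => ⟨x l - i, hm, by rw [sub_add_cancel]⟩

lemma StrongWideIn.map {N : Type*} [L.Structure N] (e : M ≃[L] N) {t : ℕ}
    {φ : L.Formula (Fin 1 ⊕ Fin t)} (h : StrongWideIn M φ) : StrongWideIn N φ := by
  obtain ⟨a, c, σ, ε, hε, hw⟩ := h
  let τ : N ≃[L] N := (e.comp σ).comp e.symm
  refine ⟨e a, e ∘ c, τ, ε, hε, ?_⟩
  let s : Equiv.Perm M := σ.toEquiv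
  have hstep : ∀ m, τ.toEquiv (e m) = e (s m) := fun m => by
    change e (σ (e.symm (e m))) = e (σ m)
    rw [e.symm_apply_apply]
  have hpow : ∀ (i : ℤ) m, (τ.toEquiv ^ i : Equiv.Perm N) (e m) = e ((s ^ i) m) := by
    intro i
    change ∀ m, ((show Equiv.Perm N from τ.toEquiv) ^ i) (e m) = e ((s ^ i) m)
    induction i with
    | zero => exact fun m => rfl
    | succ i ih =>
      intro m
      rw [zpow_add_one, zpow_add_one, Equiv.Perm.mul_apply, Equiv.Perm.mul_apply, ← ih]
      exact congrArg _ (hstep m)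
    | pred i ih =>
      intro m
      rw [zpow_sub_one, zpow_sub_one, Equiv.Perm.mul_apply, Equiv.Perm.mul_apply, ← ih]
      refine congrArg _ ?_
      rw [Equiv.Perm.inv_eq_iff_eq]
      exact (congrArg e (s.apply_symm_apply _)).symm.trans (hstep _).symm
  have : returnSet τ.toEquiv (inst N φ (e ∘ c)) (e a) = returnSet σ.toEquiv (inst M φ c) a := by
    ext i
    change (τ.toEquiv ^ i : Equiv.Perm N) (e a) ∈ inst N φ (e ∘ c) ↔ (s ^ i) a ∈ inst M φ c
    rw [hpow, apply_mem_inst]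
  rw [this]
  exact hw

/-- In an uncountable saturated structure a formula with the independence property yields a strong
wide formula: the shift along an indiscernible sequence extends to an automorphism, and some
parameter cuts out the Thue–Morse set. -/
lemma HasIPIn.exists_strongWideIn [Nonempty M] (hM : IsSaturated L M) (hunc : ℵ₀ < #M)
    {k t : ℕ} {φ : L.Formula (Fin k ⊕ Fin t)} (h : HasIPIn M φ) :
    ∃ (s : ℕ) (ψ : L.Formula (Fin 1 ⊕ Fin s)), StrongWideIn M ψ := by
  obtain ⟨s, ψ, hψ⟩ := h.exists_singleton hM hunc.le
  obtain ⟨J, ε, hε, hJ⟩ := exists_isWide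
  obtain ⟨a, c, ha, hac⟩ := hψ.exists_indiscernible hM hunc.le J
  obtain ⟨σ, hσ⟩ := exists_automorphism hM hunc ha.sameType_add_one
  refine ⟨s, ψ, a 0 0, c, σ, ε, hε, ?_⟩
  let p : Equiv.Perm M := σ.toEquiv
  have hp : ∀ k, p (a k 0) = a (k + 1) 0 := hσ
  have hpow : ∀ i : ℤ, (p ^ i) (a 0 0) = a i 0 := by
    intro i
    induction i with
    | zero => rfl
    | succ i ih => rw [add_comm, zpow_one_add, Equiv.Perm.mul_apply, ih, hp, add_comm]
    | pred i ih =>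
      rw [sub_eq_neg_add, zpow_add, Equiv.Perm.mul_apply, ih, zpow_neg_one,
        Equiv.Perm.inv_eq_iff_eq, hp]
      ring_nf
  have : returnSet σ.toEquiv (inst M ψ c) (a 0 0) = J := by
    ext i
    change (p ^ i) (a 0 0) ∈ inst M ψ c ↔ _
    rw [hpow, ← hac i, mem_inst]
    refine iff_of_eq (congrArg (fun x => ψ.Realize (Sum.elim x c)) ?_)
    ext x
    rw [Subsingleton.elim x 0]
  rw [this]
  exact hJ

end Automorphisms

/-! ### Noncompact systems and the independence property -/

section Measures

open FirstOrder.Language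

variable {L : FirstOrder.Language.{u, v}} {M : Type w} [L.Structure M]

open Classical in
/-- Measure-separated sets are separated on average: the first moment of the number of
separated pairs is large. -/
lemma exists_separating_point {X : Type*} [MeasurableSpace X] (μ : Measure X)
    [IsProbabilityMeasure μ] (E : ℕ → Set X) (hE : ∀ i, MeasurableSet (E i)) {δ : ℝ}
    (hδ : 0 < δ) (hsep : ∀ i j, i ≠ j → ENNReal.ofReal δ ≤ μ (symmDiff (E i) (E j)))
    (P : Finset (ℕ × ℕ)) (hP : ∀ p ∈ P, p.1 ≠ p.2) :
    ∃ x, δ * (P.card : ℝ) ≤ ((P.filter fun p => x ∈ symmDiff (E p.1) (E p.2)).card : ℝ) := by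
  let f : X → ENNReal := fun x => ∑ p ∈ P, (symmDiff (E p.1) (E p.2)).indicator 1 x
  have hf : ∀ x, f x = ((P.filter fun p => x ∈ symmDiff (E p.1) (E p.2)).card : ENNReal) := by
    intro x
    simp only [f, Set.indicator_apply, Pi.one_apply]
    rw [Finset.sum_boole]
  have hmeas : ∀ p ∈ P, Measurable ((symmDiff (E p.1) (E p.2)).indicator (1 : X → ENNReal)) :=
    fun p _ => measurable_one.indicator ((hE _).symmDiff (hE _))
  have hint : ∫⁻ x, f x ∂μ = ∑ p ∈ P, μ (symmDiff (E p.1) (E p.2)) := by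
    rw [lintegral_finsetSum _ hmeas]
    exact Finset.sum_congr rfl fun p _ => lintegral_indicator_one ((hE _).symmDiff (hE _))
  have hlow : (P.card : ENNReal) * ENNReal.ofReal δ ≤ ∫⁻ x, f x ∂μ := by
    rw [hint, ← nsmul_eq_mul, ← Finset.sum_const]
    exact Finset.sum_le_sum fun p hp => hsep _ _ (hP p hp)
  obtain ⟨x, hx⟩ := exists_lintegral_le (μ := μ) (f := f) (by
    rw [hint]
    exact ENNReal.sum_ne_top.2 fun p _ => measure_ne_top _ _)
  refine ⟨x, ?_⟩
  have h1 := hlow.trans hx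
  rw [hf] at h1
  have h2 := ENNReal.toReal_mono (ENNReal.natCast_ne_top _) h1
  rw [ENNReal.toReal_mul, ENNReal.toReal_natCast, ENNReal.toReal_natCast,
    ENNReal.toReal_ofReal hδ.le] at h2
  linarith

lemma symmDiff_image_equiv {X : Type*} (s : Equiv.Perm X) (A B : Set X) :
    symmDiff (s '' A) (s '' B) = s '' symmDiff A B :=
  (Set.image_symmDiff s.injective A B).symm

/-- In a noncompact measure-preserving system some member of a generating algebra has uniformly
separated translates: it approximates a set whose translates never return close to it. -/
lemma exists_separated_of_not_isCompactSystem {X : Type*} [mX : MeasurableSpace X] (μ : Measure X)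
    [IsProbabilityMeasure μ] {s : Equiv.Perm X} (hs : IsInvariant μ s) {C : Set (Set X)}
    (hC : IsSetRing C) (hCu : Set.univ ∈ C) (hgen : mX = MeasurableSpace.generateFrom C)
    (hncpt : ¬ IsCompactSystem μ s) :
    ∃ δ : ℝ, 0 < δ ∧ ∃ D ∈ C, (∀ i : ℕ, MeasurableSet ((s ^ i : Equiv.Perm X) '' D)) ∧
      ∀ i j : ℕ, i ≠ j → ENNReal.ofReal δ ≤
        μ (symmDiff ((s ^ i : Equiv.Perm X) '' D) ((s ^ j : Equiv.Perm X) '' D)) := by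
  simp only [IsCompactSystem, not_forall, not_exists, not_and, not_lt] at hncpt
  obtain ⟨ε, hε, B, hB, hsep⟩ := hncpt
  have hpre : ∀ (i : ℕ) (A : Set X), (s ^ i : Equiv.Perm X) '' A = (s.symm^[i]) ⁻¹' A := by
    intro i A
    rw [Equiv.image_eq_preimage_symm, ← Equiv.Perm.coe_pow]
    rfl
  have hmp : ∀ i : ℕ, MeasurePreserving (s.symm^[i]) μ μ := fun i => hs.2.iterate i
  have hmeas : ∀ (i : ℕ) {A : Set X}, MeasurableSet A →
      MeasurableSet ((s ^ i : Equiv.Perm X) '' A) := fun i A hA => by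
    rw [hpre]
    exact (hmp i).measurable hA
  have hμ : ∀ (i : ℕ) {A : Set X}, MeasurableSet A → μ ((s ^ i : Equiv.Perm X) '' A) = μ A :=
    fun i A hA => by
      rw [hpre]
      exact (hmp i).measure_preimage hA.nullMeasurableSet
  obtain ⟨D, hDC, hD⟩ := exists_measure_symmDiff_lt_of_generateFrom_isSetRing (μ := μ) hC
    ⟨{Set.univ}, Set.countable_singleton _, by simpa using hCu, by simp⟩ hgen hB
    (ε := ENNReal.ofReal (ε / 3)) (by simpa using hε)
  have hDm : MeasurableSet D := by
    rw [hgen]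
    exact MeasurableSpace.measurableSet_generateFrom hDC
  have hret : ∀ k : ℕ, 0 < k →
      ENNReal.ofReal (ε / 3) ≤ μ (symmDiff ((s ^ k : Equiv.Perm X) '' D) D) := by
    intro k hk
    by_contra! hlt
    have h1 : μ (symmDiff ((s ^ k : Equiv.Perm X) '' B) ((s ^ k : Equiv.Perm X) '' D)) <
        ENNReal.ofReal (ε / 3) := by
      rw [symmDiff_image_equiv, hμ k (hB.symmDiff hDm), symmDiff_comm]
      exact hD
    have h2 := (measure_symmDiff_le (μ := μ) ((s ^ k : Equiv.Perm X) '' B)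
      ((s ^ k : Equiv.Perm X) '' D) B).trans
      (add_le_add_right (measure_symmDiff_le (μ := μ) ((s ^ k : Equiv.Perm X) '' D) D B) _)
    have h3 := (hsep k hk).trans_lt (h2.trans_lt (ENNReal.add_lt_add h1 (ENNReal.add_lt_add hlt hD)))
    rw [← ENNReal.ofReal_add (by positivity) (by positivity),
      ← ENNReal.ofReal_add (by positivity) (by positivity)] at h3
    ring_nf at h3
    exact lt_irrefl _ h3
  refine ⟨ε / 3, by positivity, D, hDC, fun i => hmeas i hDm, fun i j hij => ?_⟩
  wlog hlt : i < j generalizing i j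
  · rw [symmDiff_comm]
    exact this j i hij.symm (by omega)
  obtain ⟨k, rfl⟩ := Nat.exists_eq_add_of_lt hlt
  have h1 : (s ^ (i + k + 1) : Equiv.Perm X) '' D =
      (s ^ i : Equiv.Perm X) '' ((s ^ (k + 1) : Equiv.Perm X) '' D) := by
    rw [add_assoc, pow_add, Equiv.Perm.coe_mul, Set.image_comp]
  rw [h1, symmDiff_image_equiv, hμ i (hDm.symmDiff (hmeas _ hDm)), symmDiff_comm]
  exact hret _ k.succ_pos

/-- Noncompactness of a definable system produces an instance of a formula with uniformly
separated translates, hence infinite VC dimension. -/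
lemma HasNoncompactSystem.exists_hasIPIn {A : Set M} (h : HasNoncompactSystem L M A) :
    ∃ (t : ℕ) (φ : L.Formula (Fin 1 ⊕ Fin t)), HasIPIn M φ := by
  let _ : MeasurableSpace M := defSigmaAlgebra L M A
  obtain ⟨σ, -, μ, hμ, hinv, hncpt⟩ := h
  obtain ⟨δ, hδ, D, hD, hmeas, hsep⟩ := exists_separated_of_not_isCompactSystem μ hinv
    (isSetRing_definable₁ A) (definable₁_univ A) rfl hncpt
  obtain ⟨t, φ, c, rfl⟩ := exists_eq_inst hD
  refine ⟨t, φ, fun n => ?_⟩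
  let s : Equiv.Perm M := σ.toEquiv
  obtain ⟨x, hx⟩ := exists_shattered_of_separated
    (fun i : ℕ => (s ^ i : Equiv.Perm M) '' inst M φ c) hδ
    (fun P hP _ => exists_separating_point μ _ hmeas hδ hsep P hP) n
  refine ⟨fun l _ => x l, fun J => ?_⟩
  obtain ⟨i, hi⟩ := hx J
  refine ⟨(s ^ (i : ℤ) : Equiv.Perm M) ∘ c, fun l => ?_⟩
  rw [← hi l]
  change x l ∈ inst M φ ((s ^ (i : ℤ) : Equiv.Perm M) ∘ c) ↔
    x l ∈ (s ^ i : Equiv.Perm M) '' inst M φ c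
  rw [← (s ^ i).apply_symm_apply (x l), (s ^ i).injective.mem_set_image, ← zpow_natCast]
  exact zpow_mem_inst σ φ i c _

/-! ### The global measure attached to a wide orbit -/

/-- In an uncountable saturated structure, a decreasing sequence of nonempty definable sets has a
common point. -/
lemma exists_eq_empty_of_iInter_eq_empty (hM : IsSaturated L M) (hunc : ℵ₀ < #M) {s : ℕ → Set M}
    (hs : ∀ n, (Set.univ : Set M).Definable₁ L (s n)) (hanti : Antitone s)
    (hempty : ⋂ n, s n = ∅) : ∃ n, s n = ∅ := by
  by_contra! hne
  choose A _ hA using fun n => Set.definable_iff_finitely_definable.1 (hs n)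
  have hcount : (⋃ n, (A n : Set M)).Countable :=
    Set.countable_iUnion fun n => (A n).countable_toSet
  obtain ⟨m, hm⟩ := IsKSaturated.exists_mem_of_fip hM
    (A := ⋃ n, (A n : Set M)) ((mk_le_aleph0_iff.2 hcount.to_subtype).trans_lt hunc) s
    (fun n => (hA n).mono (Set.subset_iUnion (fun n => (A n : Set M)) n)) (by
      intro G
      obtain ⟨m, hm⟩ := hne (G.sup id)
      exact ⟨m, fun j hj => hanti (Finset.le_sup (f := id) hj) hm⟩)
  have : m ∈ ⋂ n, s n := Set.mem_iInter.2 hm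
  rw [hempty] at this
  exact this

/-- Every finitely additive probability on the definable sets of an uncountable saturated
structure extends to a countably additive one. -/
lemma exists_measure_of_additive (hM : IsSaturated L M) (hunc : ℵ₀ < #M) (ν : Set M → ℝ)
    (hpos : ∀ s, 0 ≤ ν s) (huniv : ν Set.univ = 1)
    (hadd : ∀ s t, Disjoint s t → ν (s ∪ t) = ν s + ν t) :
    letI : MeasurableSpace M := defSigmaAlgebra L M Set.univ
    ∃ μ : Measure M, IsProbabilityMeasure μ ∧
      ∀ s, (Set.univ : Set M).Definable₁ L s → μ s = ENNReal.ofReal (ν s) := by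
  let _ : MeasurableSpace M := defSigmaAlgebra L M Set.univ
  have hring := isSetRing_definable₁ (L := L) (Set.univ : Set M)
  have hνempty : ν ∅ = 0 := by
    have := hadd ∅ ∅ disjoint_bot_left
    rw [Set.union_empty] at this
    linarith
  let m : AddContent ENNReal {s : Set M | (Set.univ : Set M).Definable₁ L s} :=
    hring.addContent_of_union (fun s => ENNReal.ofReal (ν s)) (by simp [hνempty])
      (fun {s t} _ _ hst => by
        change ENNReal.ofReal (ν (s ∪ t)) = ENNReal.ofReal (ν s) + ENNReal.ofReal (ν t)
        rw [hadd s t hst, ENNReal.ofReal_add (hpos s) (hpos t)])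
  have hm : ∀ s, m s = ENNReal.ofReal (ν s) := fun s => rfl
  have hsub : m.IsSigmaSubadditive := by
    refine isSigmaSubadditive_of_addContent_iUnion_eq_tsum hring fun f hf hU hdisj =>
      addContent_iUnion_eq_sum_of_tendsto_zero hring m (fun s _ => ?_) ?_ hf hU hdisj
    · rw [hm]
      exact ENNReal.ofReal_ne_top
    · intro s hs hanti hempty
      obtain ⟨n, hn⟩ := exists_eq_empty_of_iInter_eq_empty hM hunc hs hanti hempty
      refine tendsto_const_nhds.congr' ?_
      filter_upwards [eventually_ge_atTop n] with k hk
      have : s k = ∅ := Set.subset_empty_iff.1 ((hanti hk).trans hn.subset)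
      rw [this, addContent_empty]
  have heq : ∀ s, (Set.univ : Set M).Definable₁ L s →
      m.measure hring.isSetSemiring le_rfl hsub s = ENNReal.ofReal (ν s) := fun s hs =>
    m.measure_eq hring.isSetSemiring rfl hsub hs
  refine ⟨m.measure hring.isSetSemiring le_rfl hsub, ⟨?_⟩, heq⟩
  rw [heq _ (definable₁_univ _), huniv, ENNReal.ofReal_one]

/-- The frequency of visits of a wide orbit is a shift-invariant Keisler measure; its countably
additive extension gives a noncompact system, since the translates of the wide instance stay apart
in measure. -/
lemma StrongWideIn.hasNoncompactSystem (hM : IsSaturated L M) (hunc : ℵ₀ < #M) {t : ℕ}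
    {φ : L.Formula (Fin 1 ⊕ Fin t)} (h : StrongWideIn M φ) :
    HasNoncompactSystem L M Set.univ := by
  obtain ⟨a, c, σ, ε, hε, hw⟩ := h
  obtain ⟨d, hd0, hd1, hd2, hd3, hd4⟩ := exists_invariant_mean
  let _ : MeasurableSpace M := defSigmaAlgebra L M Set.univ
  let s : Equiv.Perm M := σ.toEquiv
  obtain ⟨μ, hμ, hμν⟩ := exists_measure_of_additive hM hunc (fun B => d (returnSet s B a))
    (fun B => hd0 _) hd1 (fun B C hBC => hd2 _ _
      (Set.disjoint_left.2 fun i hi hi' => Set.disjoint_left.1 hBC hi hi'))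
  have hshift : ∀ (B : Set M) (i j : ℤ), i ∈ returnSet s ((s ^ j : Equiv.Perm M) ⁻¹' B) a ↔
      i ∈ shift (-j) (returnSet s B a) := by
    intro B i j
    rw [mem_shift]
    change (s ^ j) ((s ^ i) a) ∈ B ↔ (s ^ (i - -j)) a ∈ B
    rw [← Equiv.Perm.mul_apply, ← zpow_add, sub_neg_eq_add, add_comm]
  have hmp : ∀ (τ : M ≃[L] M) (j : ℤ), (τ : M → M) = (s ^ j : Equiv.Perm M) →
      MeasurePreserving τ μ μ := by
    intro τ j hτ
    have hmeas : Measurable τ := measurable_generateFrom fun B hB =>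
      MeasurableSpace.measurableSet_generateFrom (definable₁_preimage τ hB)
    refine ⟨hmeas, ?_⟩
    have : IsProbabilityMeasure (μ.map τ) := Measure.isProbabilityMeasure_map hmeas.aemeasurable
    refine ext_of_generate_finite _ rfl (isSetRing_definable₁ _).isSetSemiring.isPiSystem
      (fun B hB => ?_) (by rw [measure_univ, measure_univ])
    rw [Measure.map_apply hmeas (MeasurableSpace.measurableSet_generateFrom hB),
      hμν _ (definable₁_preimage τ hB), hμν _ hB]
    have h1 : returnSet s (τ ⁻¹' B) a = shift (-j) (returnSet s B a) := by
      ext i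
      rw [hτ]
      exact hshift B i j
    rw [h1, hd3]
  refine ⟨σ, ?_, μ, hμ, ⟨hmp σ 1 ?_, hmp σ.symm (-1) ?_⟩, fun hcpt => ?_⟩
  · rintro rfl
    have := hw.injective_zpow hε (show ((s ^ (0 : ℤ)) a = (s ^ (1 : ℤ)) a) from rfl)
    exact absurd this (by decide)
  · rw [zpow_one]
    rfl
  · rw [zpow_neg_one]
    rfl
  · have hBdef := definable₁_inst φ c
    obtain ⟨n, hn, hlt⟩ := hcpt ε hε (inst M φ c) (MeasurableSpace.measurableSet_generateFrom hBdef)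
    have himage : (s ^ n : Equiv.Perm M) '' inst M φ c =
        (s ^ (-(n : ℤ)) : Equiv.Perm M) ⁻¹' inst M φ c := by
      rw [Equiv.image_eq_preimage_symm, zpow_neg, zpow_natCast]
      rfl
    have himage' : (s ^ n : Equiv.Perm M) '' inst M φ c =
        inst M φ ((s ^ (n : ℤ) : Equiv.Perm M) ∘ c) := by
      ext m
      rw [← (s ^ n).apply_symm_apply m, (s ^ n).injective.mem_set_image, ← zpow_natCast]
      exact (zpow_mem_inst σ φ n c _).symm
    have hdef : (Set.univ : Set M).Definable₁ L
        (symmDiff ((s ^ n : Equiv.Perm M) '' inst M φ c) (inst M φ c)) := by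
      rw [himage']
      exact ((definable₁_inst φ _).sdiff hBdef).union (hBdef.sdiff (definable₁_inst φ _))
    have hret : returnSet s (symmDiff ((s ^ n : Equiv.Perm M) '' inst M φ c) (inst M φ c)) a =
        symmDiff (shift n (returnSet s (inst M φ c) a)) (shift 0 (returnSet s (inst M φ c) a)) := by
      have h1 : returnSet s ((s ^ n : Equiv.Perm M) '' inst M φ c) a =
          shift n (returnSet s (inst M φ c) a) := by
        ext i
        rw [himage, hshift, neg_neg]
      rw [← h1, shift_zero]
      rfl
    obtain ⟨r, hr, hdens⟩ := hw.exists_hasDensity_symmDiff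
      (show (n : ℤ) ≠ 0 by exact_mod_cast hn.ne')
    have hval : μ (symmDiff ((s ^ n : Equiv.Perm M) '' inst M φ c) (inst M φ c)) =
        ENNReal.ofReal (r / 2) := by
      rw [hμν _ hdef, hret]
      exact congrArg _ (hd4 _ _ hdens)
    have hlt' : μ (symmDiff ((s ^ n : Equiv.Perm M) '' inst M φ c) (inst M φ c)) <
      ENNReal.ofReal ε := hlt
    rw [hval, ENNReal.ofReal_lt_ofReal_iff hε] at hlt'
    linarith

end Measures

end WideNIP

theorem theorem3 {L : FirstOrder.Language.{u, v}} (T : L.Theory) (hT : T.IsComplete)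
    (M : Type w) [L.Structure M] [Nonempty M] [T.Model M]
    (hM : WideNIP.IsSaturated L M) (hM' : Cardinal.mk M ≠ Cardinal.aleph0) :
    List.TFAE [
      WideNIP.HasIP.{u, v, w} T,
      ∃ A : Set M, WideNIP.HasNoncompactSystem L M A,
      WideNIP.HasNoncompactSystem L M Set.univ,
      WideNIP.IsWeakWide.{u, v, w} T,
      WideNIP.IsStrongWide.{u, v, w} T] := by
  -- the copy of `M` in the universe in which models of `T` are quantified
  let N : FirstOrder.Language.Theory.ModelType.{u, v, max u v w} T :=
    FirstOrder.Language.Theory.ModelType.equivInduced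
      (M := FirstOrder.Language.Theory.ModelType.of T M) Equiv.ulift.{max u v}.symm
  let e : FirstOrder.Language.Equiv L M N := Equiv.inducedStructureEquiv Equiv.ulift.{max u v}.symm
  have hstrong : WideNIP.HasIP.{u, v, w} T → Cardinal.aleph0 < Cardinal.mk M ∧
      ∃ (s : ℕ) (ψ : L.Formula (Fin 1 ⊕ Fin s)), WideNIP.StrongWideIn M ψ := by
    rintro ⟨k, t, φ, N', hφ⟩
    have hφM : WideNIP.HasIPIn M φ := WideNIP.HasIPIn.transfer (M := N') hT hφ
    have := hφM.infinite
    have hunc : Cardinal.aleph0 < Cardinal.mk M :=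
      lt_of_le_of_ne (Cardinal.infinite_iff.1 this) hM'.symm
    exact ⟨hunc, hφM.exists_strongWideIn hM hunc⟩
  tfae_have 1 → 5 := fun h => by
    obtain ⟨-, s, ψ, hψ⟩ := hstrong h
    exact ⟨s, ψ, N, hψ.map e⟩
  tfae_have 5 → 4 := by
    rintro ⟨t, φ, N', h⟩
    exact ⟨t, φ, N', h.weakWideIn⟩
  tfae_have 4 → 1 := by
    rintro ⟨t, φ, N', h⟩
    exact ⟨1, t, φ, N', h.hasIPIn⟩
  tfae_have 1 → 3 := fun h => by
    obtain ⟨hunc, s, ψ, hψ⟩ := hstrong h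
    exact hψ.hasNoncompactSystem hM hunc
  tfae_have 3 → 2 := fun h => ⟨_, h⟩
  tfae_have 2 → 1 := by
    rintro ⟨A, hA⟩
    obtain ⟨t, φ, hφ⟩ := hA.exists_hasIPIn
    exact ⟨1, t, φ, N, WideNIP.HasIPIn.transfer (M := M) hT hφ⟩
  tfae_finish
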